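/- Let $N\ge 1$ be an integer, $\delta\in\{1,-1\}$, let $A,S\in\mathbb{C}^{2N\times 2N}$ with $A$ invertible and $A^2=\delta S^2$, and let $C\in\mathbb{C}^{2N}$. For $(x,t)\in\mathbb{R}^2$ put $$\phi(x,t)=\exp\Bigl(\tfrac{i}{2}A^{2}x+\tfrac{i}{2}A^{-2}t\Bigr)C ,\qquad \phi_-(x,t)=\phi(-x,-t).$$ For $2N\times 2N$ matrices $P,Q$ and $k+l=2N$ with $k,l\ge 0$ let $$D_{k,l}[P;Q](x,t)=\det\bigl(P\phi,\,P\partial_x\phi,\dots,P\partial_x^{k-1}\phi,\;Q\phi_-,\,Q\partial_x\phi_-,\dots,Q\partial_x^{l-1}\phi_-\bigr)(x,t),$$ and, with $|A|=\det A$ and $I$ the identity matrix, $$\begin{aligned} f&=(-2i)^{-N}D_{N,N}[A^2;S], & \tilde h&=-(2i)^{1-N}|A|\,D_{N+1,N-1}[I;S],\\ h&=-i(2i)^{1-N}|A|^{-1}D_{N-1,N+1}[A^4;S], & g&=(-1)^{N-1}2^{1-2N}|A|\,D_{N+1,N-1}[I;A^2S],\\ s&=2^{-2N}|A|^2D_{N,N}[I;S].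 \end{aligned}$$ Then: 1. For all $(x,t)\in\mathbb{R}^2$, $s(x,t)\neq 0$ if and only if $f(-x,-t)\ne 0$, and in this case $$ i\,\frac{g(x,t)}{s(x,t)}=-i\delta\,\frac{h(-x,-t)}{f(-x,-t)} .$$ 2. The set $\Omega=\{(x,t)\in\mathbb{R}^2: f(x,t)\ne 0,\ s(x,t)\neq 0\}$ is open and invariant under $(x,t)\mapsto(-x,-t)$, and the functions $$q_1=\frac{\tilde h}{f},\qquad q_3=i\,\frac{g}{s}$$ are $C^\infty$ on $\Omega$ and satisfy there the nonlocal massive Thirring model $$ i\,q_{1,t}+q_3+\delta\, q_1q_3\,q_3(-x,-t)=0,\qquad i\,q_{3,x}+q_1+\delta\, q_3q_1\,q_1(-x,-t)=0 .$$ -/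

import Mathlib

open scoped ContDiff

noncomputable section

namespace NonlocalMTM

/-- The vector `φ(x,t) = exp((i/2) A² x + (i/2) A⁻² t) C`. -/
def phi {n : ℕ} (A : Matrix (Fin n) (Fin n) ℂ) (C : Fin n → ℂ) (x t : ℝ) : Fin n → ℂ :=
  (NormedSpace.exp ((Complex.I / 2 * (x : ℂ)) • A ^ 2
    + (Complex.I / 2 * (t : ℂ)) • (A ^ 2)⁻¹)).mulVec C

/-- The `n × n` determinant
`| P u, P ∂u, …, P ∂^(k-1) u ; Q v, Q ∂v, …, Q ∂^(n-k-1) v |` at the point `x`: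
the first `k` columns come from `u`, the remaining `n - k` columns from `v`. -/
def doubleWronskian {n : ℕ} (k : ℕ) (P : Matrix (Fin n) (Fin n) ℂ) (u : ℝ → Fin n → ℂ)
    (Q : Matrix (Fin n) (Fin n) ℂ) (v : ℝ → Fin n → ℂ) (x : ℝ) : ℂ :=
  Matrix.det (Matrix.of fun i j : Fin n =>
    if (j : ℕ) < k then P.mulVec (iteratedDeriv (j : ℕ) u x) i
    else Q.mulVec (iteratedDeriv ((j : ℕ) - k) v x) i)

/-- The determinant with `k` columns `P ∂_x^j [φ(x,t)]`, `0 ≤ j ≤ k-1`, followed by `2N - k`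
columns `Q ∂_x^j [φ(-x,-t)]`, `0 ≤ j ≤ 2N-k-1` (all derivatives are with respect to `x`). -/
def phiDet {N : ℕ} (A : Matrix (Fin (2 * N)) (Fin (2 * N)) ℂ) (C : Fin (2 * N) → ℂ)
    (k : ℕ) (P Q : Matrix (Fin (2 * N)) (Fin (2 * N)) ℂ) (x t : ℝ) : ℂ :=
  doubleWronskian k P (fun y => phi A C y t) Q (fun y => phi A C (-y) (-t)) x

variable {N : ℕ} (A S : Matrix (Fin (2 * N)) (Fin (2 * N)) ℂ) (C : Fin (2 * N) → ℂ)

/-- `f` : `N` columns from `φ(x,t)` and `N` columns from `φ(-x,-t)`. -/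
def f (x t : ℝ) : ℂ :=
  (-2 * Complex.I) ^ (-(N : ℤ)) * phiDet A C N (A ^ 2) S x t

/-- `h̃` : `N + 1` columns from `φ(x,t)` and `N - 1` columns from `φ(-x,-t)`. -/
def hTilde (x t : ℝ) : ℂ :=
  -(2 * Complex.I) ^ (1 - (N : ℤ)) * A.det * phiDet A C (N + 1) 1 S x t

/-- `h` : `N - 1` columns from `φ(x,t)` and `N + 1` columns from `φ(-x,-t)`. -/
def h (x t : ℝ) : ℂ :=
  -Complex.I * (2 * Complex.I) ^ (1 - (N : ℤ)) * A.det⁻¹ * phiDet A C (N - 1) (A ^ 4) S x t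

/-- `g` : `N + 1` columns from `φ(x,t)` and `N - 1` columns from `φ(-x,-t)`. -/
def g (x t : ℝ) : ℂ :=
  (-1 : ℂ) ^ ((N : ℤ) - 1) * (2 : ℂ) ^ (1 - 2 * (N : ℤ)) * A.det
    * phiDet A C (N + 1) 1 (A ^ 2 * S) x t

/-- `s` : `N` columns from `φ(x,t)` and `N` columns from `φ(-x,-t)`. -/
def s (x t : ℝ) : ℂ :=
  (2 : ℂ) ^ (-2 * (N : ℤ)) * A.det ^ 2 * phiDet A C N 1 S x t

/-- `q₁ = h̃ / f`. -/
def q₁ (x t : ℝ) : ℂ := hTilde A S C x t / f A S C x t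

/-- `q₃ = i g / s`. -/
def q₃ (x t : ℝ) : ℂ := Complex.I * (g A S C x t / s A S C x t)

/-- `(w, z)` is a (classical, smooth) solution on `Ω` of the nonlocal massive Thirring model
`i w_t + z + δ w z z(-x,-t) = 0`, `i z_x + w + δ z w w(-x,-t) = 0`.  Here `Ω` has to be an open
subset of the `(x,t)`-plane that is invariant under `(x,t) ↦ (-x,-t)`. -/
def IsSolutionOn (δ : ℂ) (Ω : Set (ℝ × ℝ)) (w z : ℝ → ℝ → ℂ) : Prop :=
  IsOpen Ω ∧ (∀ x t : ℝ, (x, t) ∈ Ω → (-x, -t) ∈ Ω) ∧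
  ContDiffOn ℝ ∞ (fun p : ℝ × ℝ => w p.1 p.2) Ω ∧
  ContDiffOn ℝ ∞ (fun p : ℝ × ℝ => z p.1 p.2) Ω ∧
  ∀ x t : ℝ, (x, t) ∈ Ω →
    Complex.I * deriv (fun τ : ℝ => w x τ) t + z x t + δ * w x t * z x t * z (-x) (-t) = 0 ∧
    Complex.I * deriv (fun ξ : ℝ => z ξ t) x + w x t + δ * z x t * w x t * w (-x) (-t) = 0

end NonlocalMTM

end

/-! Put `B = A ^ 2`, `u = φ(x,t)`, `v = S φ(-x,-t)`, `N = m + 1`, and write `K k a b` for `krylovDet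
B u v k a b`. Differentiating `φ` in `x` multiplies it by `(i/2) B`, and `S` commutes with `B`
because `B = δ S²`. Hence `f`, `h̃`, `h`, `g`, `s` are constant multiples of `K (m+1) 1 0`, `K (m+2)
0 0`, `K m 2 0`, `K (m+2) 0 1`, `K (m+1) 0 0` (`tauFunctions_eq`). Three facts then suffice.

Reflection. Under `(x,t) ↦ (-x,-t)` the roles of `φ(x,t)` and `φ(-x,-t)` are exchanged. Since `B = δ
S²`, factoring `S` out of all rows and swapping the blocks turns the reflected determinant back into
one at `(x,t)` (`krylovDet_reverse`). This proves the first claim and removes the nonlocal factors.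

Evolution. `u` and `φ(-x,-t)` move along opposite flows. Up to a factor common to all determinants,
which cancels in ratios, only `v` moves (`krylovDet_flow`). The flow of `B` or `B⁻¹` then changes
only the last or first vector of the `v` block, and a three-term Plücker relation collapses the
numerator of the quotient rule to a single product (`hasDerivAt_ratio_up`, `hasDerivAt_ratio_down`).

Bilinear identity. After these substitutions each equation of the model is an instance of one
further Plücker relation, `krylovDet_bilinear`. -/

namespace NonlocalMTM

open Matrix

/-! ### Determinants of lists of vectors and the Plücker relation. -/

section ListDeterminants

variable {n : ℕ}

/-- The determinant whose rows are the entries of a list of vectors. -/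
def listDet (L : List (Fin n → ℂ)) : ℂ :=
  Matrix.det (Matrix.of fun j : Fin n => L.getD j 0)

lemma listDet_append_swap (L₁ L₂ : List (Fin n → ℂ)) (a b : Fin n → ℂ)
    (hl : L₁.length + 1 < n) :
    listDet (L₁ ++ a :: b :: L₂) = -listDet (L₁ ++ b :: a :: L₂) := by
  have h := (Matrix.detRowAlternating (R := ℂ) (n := Fin n)).map_swap
    (fun j : Fin n => (L₁ ++ b :: a :: L₂).getD j 0)
    (i := ⟨L₁.length, by omega⟩) (j := ⟨L₁.length + 1, hl⟩) (by simp)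
  have key : ((fun j : Fin n => (L₁ ++ b :: a :: L₂).getD j 0) ∘
      Equiv.swap (⟨L₁.length, by omega⟩ : Fin n) ⟨L₁.length + 1, hl⟩) =
      fun j : Fin n => (L₁ ++ a :: b :: L₂).getD j 0 := by
    funext j
    simp only [Function.comp, Equiv.swap_apply_def]
    split_ifs with h₁ h₂
    · subst h₁; simp [List.getD_eq_getElem?_getD]
    · subst h₂; simp [List.getD_eq_getElem?_getD]
    · rcases lt_or_ge (j : ℕ) L₁.length with h₃ | h₃
      · simp [List.getD_eq_getElem?_getD, List.getElem?_append_left h₃]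
      · obtain ⟨d, hd⟩ : ∃ d, (j : ℕ) = L₁.length + (d + 2) := by
          have h₁' : (j : ℕ) ≠ L₁.length := fun e => h₁ (Fin.ext e)
          have h₂' : (j : ℕ) ≠ L₁.length + 1 := fun e => h₂ (Fin.ext e)
          exact ⟨j - L₁.length - 2, by omega⟩
        simp [List.getD_eq_getElem?_getD, hd, List.getElem?_append_right]
  rw [key] at h
  exact h

/-- Each vector of `L₁` that `a` passes costs one adjacent transposition. -/
lemma listDet_append_middle (L₀ L₁ L₂ : List (Fin n → ℂ)) (a : Fin n → ℂ)
    (hl : L₀.length + L₁.length + L₂.length + 1 = n) :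
    listDet (L₀ ++ (L₁ ++ a :: L₂)) = (-1) ^ L₁.length * listDet (L₀ ++ a :: (L₁ ++ L₂)) := by
  induction L₁ generalizing L₀ with
  | nil => simp
  | cons b L₁ ih =>
    have h₁ := ih (L₀ ++ [b]) (by simp at hl ⊢; omega)
    simp only [List.append_assoc, List.cons_append, List.nil_append] at h₁ ⊢
    rw [h₁, listDet_append_swap _ _ b a (by simp at hl; omega), List.length_cons, pow_succ]
    ring

lemma listDet_middle (L₁ L₂ : List (Fin n → ℂ)) (a : Fin n → ℂ)
    (hl : L₁.length + L₂.length + 1 = n) :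
    listDet (L₁ ++ a :: L₂) = (-1) ^ L₁.length * listDet (a :: (L₁ ++ L₂)) := by
  simpa using listDet_append_middle [] L₁ L₂ a (by simpa using hl)

lemma listDet_cons_middle (L₁ L₂ : List (Fin n → ℂ)) (a b : Fin n → ℂ)
    (hl : L₁.length + L₂.length + 2 = n) :
    listDet (b :: (L₁ ++ a :: L₂)) = (-1) ^ L₁.length * listDet (b :: a :: (L₁ ++ L₂)) := by
  simpa using listDet_append_middle [b] L₁ L₂ a (by simp; omega)

lemma listDet_append_comm_aux (L₀ L₁ L₂ : List (Fin n → ℂ))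
    (hl : L₀.length + L₁.length + L₂.length = n) :
    listDet (L₀ ++ (L₁ ++ L₂)) =
      (-1) ^ (L₁.length * L₂.length) * listDet (L₀ ++ (L₂ ++ L₁)) := by
  induction L₂ generalizing L₀ with
  | nil => simp
  | cons a L₂ ih =>
    have h₁ := ih (L₀ ++ [a]) (by simp at hl ⊢; omega)
    simp only [List.append_assoc, List.cons_append, List.nil_append] at h₁ ⊢
    rw [listDet_append_middle _ _ _ _ (by simp at hl; omega), h₁, List.length_cons, Nat.mul_succ,
      pow_add]
    ring

lemma listDet_append_comm (L₁ L₂ : List (Fin n → ℂ)) (hl : L₁.length + L₂.length = n) :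
    listDet (L₁ ++ L₂) = (-1) ^ (L₁.length * L₂.length) * listDet (L₂ ++ L₁) := by
  simpa using listDet_append_comm_aux [] L₁ L₂ (by simpa using hl)

lemma listDet_map_mulVec (B : Matrix (Fin n) (Fin n) ℂ) (L : List (Fin n → ℂ)) :
    listDet (L.map (B *ᵥ ·)) = B.det * listDet L := by
  unfold listDet
  rw [← Matrix.det_transpose B, mul_comm, ← Matrix.det_mul]
  congr 1
  ext j i
  have h := List.getD_map (l := L) (d := 0) (n := (j : ℕ)) (B *ᵥ ·)
  simp only [Matrix.mulVec_zero] at h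
  rw [Matrix.of_apply, h, Matrix.mul_apply]
  simp [Matrix.mulVec, dotProduct, mul_comm]

lemma listDet_append_smul_cons (L₀ L : List (Fin n → ℂ)) (a : Fin n → ℂ) (c : ℂ)
    (hl : L₀.length < n) :
    listDet (L₀ ++ (c • a) :: L) = c * listDet (L₀ ++ a :: L) := by
  have key : ∀ b : Fin n → ℂ, listDet (L₀ ++ b :: L) =
      Matrix.det (Matrix.updateRow (Matrix.of fun j : Fin n => (L₀ ++ a :: L).getD j 0)
        ⟨L₀.length, hl⟩ b) := by
    intro b
    unfold listDet
    congr 1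
    ext j i
    by_cases hj : j = ⟨L₀.length, hl⟩
    · subst hj; simp [List.getD_eq_getElem?_getD]
    · rw [Matrix.updateRow_ne hj]
      rcases lt_or_ge (j : ℕ) L₀.length with h₃ | h₃
      · simp [List.getD_eq_getElem?_getD, List.getElem?_append_left h₃]
      · obtain ⟨d, hd⟩ : ∃ d, (j : ℕ) = L₀.length + (d + 1) := by
          have h₁' : (j : ℕ) ≠ L₀.length := fun e => hj (Fin.ext e)
          exact ⟨j - L₀.length - 1, by omega⟩
        simp [List.getD_eq_getElem?_getD, hd, List.getElem?_append_right]
  rw [key (c • a), key a, Matrix.det_updateRow_smul]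

lemma listDet_append_map_smul (L₀ L : List (Fin n → ℂ)) (c : ℂ)
    (hl : L₀.length + L.length ≤ n) :
    listDet (L₀ ++ L.map (c • ·)) = c ^ L.length * listDet (L₀ ++ L) := by
  induction L generalizing L₀ with
  | nil => simp
  | cons a L ih =>
    simp only [List.length_cons] at hl
    have h₁ := ih (L₀ ++ [a]) (by simp; omega)
    simp only [List.append_assoc, List.cons_append, List.nil_append] at h₁
    rw [List.map_cons, listDet_append_smul_cons _ _ _ _ (by omega), h₁, List.length_cons, pow_succ]
    ring

/-- The three-term Plücker relation. -/
lemma listDet_pluecker (L : List (Fin n → ℂ)) (a b c d : Fin n → ℂ) (hl : L.length + 2 = n) :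
    listDet (a :: b :: L) * listDet (c :: d :: L) - listDet (a :: c :: L) * listDet (b :: d :: L)
      + listDet (a :: d :: L) * listDet (b :: c :: L) = 0 := by
  obtain ⟨m, rfl⟩ : ∃ m, n = m + 2 := ⟨L.length, hl.symm⟩
  set M : Matrix (Fin (m + 2)) (Fin (m + 2)) ℂ :=
    Matrix.of fun j => (a :: b :: L).getD j 0 with hM
  have e : ∀ x y, listDet (x :: y :: L) = ((M.updateRow 1 y).updateRow 0 x).det := by
    intro x y
    unfold listDet
    congr 1
    ext j i
    refine Fin.cases ?_ (fun j => Fin.cases ?_ (fun j => ?_) j) j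
    · simp
    · rw [Matrix.updateRow_ne (by simp), show (Fin.succ 0 : Fin (m + 2)) = 1 from rfl]; simp
    · rw [Matrix.updateRow_ne (by simp [Fin.ext_iff]), Matrix.updateRow_ne (by simp [Fin.ext_iff])]
      simp [hM]
  have hM0 : M 0 = a := by ext i; simp [hM]
  have hM1 : M 1 = b := by ext i; simp [hM]
  have h0 : ∀ x, (M.updateRow 0 x).det = listDet (x :: b :: L) := by
    intro x
    rw [e, ← hM1, Matrix.updateRow_eq_self]
  have h1 : ∀ x, (M.updateRow 1 x).det = listDet (a :: x :: L) := by
    intro x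
    rw [e, ← hM0]
    congr 1
    rw [← Matrix.updateRow_ne (M := M) (i := 1) (b := x) (by simp : (0 : Fin (m + 2)) ≠ 1),
      Matrix.updateRow_eq_self]
  have hdet : M.det = listDet (a :: b :: L) := rfl
  let l : (Fin (m + 2) → ℂ) →ₗ[ℂ] ℂ :=
    (Matrix.detRowAlternating (R := ℂ) (n := Fin (m + 2))).toMultilinearMap.toLinearMap
      (M.updateRow 1 d) 0
  -- Cramer's rule expands `c` in the rows `a, b, L` of `M`. Applying `l` kills the rows from `L`,
  -- which give a repeated row, and leaves exactly the three terms.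
  have hl' : ∀ x, l x = listDet (x :: d :: L) := fun x => (e x d).symm
  have hcr : ∑ i, (M.updateRow i c).det • M i = M.det • c := by
    have h := Matrix.mulVec_cramer Mᵀ c
    rw [Matrix.det_transpose] at h
    rw [← h]
    ext k
    simp [Matrix.mulVec, dotProduct, Matrix.cramer_transpose_apply, mul_comm]
  have h := congrArg l hcr
  rw [map_sum, Fin.sum_univ_succ, Fin.sum_univ_succ, Finset.sum_eq_zero] at h
  · rw [show (Fin.succ 0 : Fin (m + 2)) = 1 from rfl] at h
    simp only [map_smul] at h
    simp only [hl', h0, h1, hM0, hM1, hdet, smul_eq_mul, add_zero] at h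
    have hs : listDet (c :: b :: L) = -listDet (b :: c :: L) := by
      simpa using listDet_append_swap [] L c b (by simp)
    rw [hs] at h
    linear_combination -h
  · intro i _
    have hz : l (M i.succ.succ) = 0 := by
      refine Matrix.det_zero_of_row_eq (i := 0) (j := i.succ.succ) (by simp [Fin.ext_iff]) ?_
      ext k
      simp [Function.update, Matrix.updateRow, Fin.ext_iff]
    rw [map_smul, hz, smul_zero]

end ListDeterminants

/-! ### Two-block determinants: Plücker identities, shift and reflection. -/

section BlockDeterminants

variable {n : ℕ}

/-- The Plücker relation with common part `P ++ R`, whose even length makes moving `d` to the front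
of it free of sign. It will be read with `a, z` the vectors at the ends of the `u` block and `c, d`
those of the `v` block. -/
lemma listDet_outer_inner (P R : List (Fin n → ℂ)) (a z c d : Fin n → ℂ)
    (hP : P.length = R.length) (hn : 2 * P.length + 2 = n) :
    listDet (a :: P ++ z :: R) * listDet (P ++ (c :: R ++ [d]))
      - listDet (a :: P ++ c :: R) * listDet (P ++ z :: (R ++ [d]))
      + listDet (a :: P ++ (R ++ [d])) * listDet (P ++ z :: c :: R) = 0 := by
  have e₁ : ∀ x, listDet (a :: P ++ x :: R) = (-1) ^ P.length * listDet (a :: x :: (P ++ R)) :=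
    fun x => listDet_cons_middle P R x a (by omega)
  have e₂ : ∀ x, listDet (P ++ x :: (R ++ [d])) =
      (-1) ^ P.length * listDet (x :: d :: (P ++ R)) := by
    intro x
    rw [listDet_middle P (R ++ [d]) x (by simp; omega), ← List.append_assoc,
      listDet_cons_middle (P ++ R) [] d x (by simp; omega), List.append_nil, List.length_append,
      ← hP, ← two_mul, pow_mul]
    norm_num
  have e₃ : listDet (a :: P ++ (R ++ [d])) = listDet (a :: d :: (P ++ R)) := by
    have h := listDet_cons_middle (P ++ R) [] d a (by simp; omega)
    rw [List.append_nil, List.length_append, ← hP, ← two_mul, pow_mul] at h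
    simpa using h
  have e₄ : listDet (P ++ z :: c :: R) = listDet (z :: c :: (P ++ R)) := by
    rw [listDet_middle P (c :: R) z (by simp; omega), listDet_cons_middle P R c z (by omega),
      ← mul_assoc, ← mul_pow]
    norm_num
  have hs : ((-1 : ℂ) ^ P.length) * (-1) ^ P.length = 1 := by rw [← mul_pow]; norm_num
  have h := listDet_pluecker (P ++ R) a z c d (by simp; omega)
  simp only [List.cons_append] at e₁ e₃ ⊢
  rw [e₁, e₁, e₂, e₂, e₃, e₄]
  linear_combination h + (listDet (a :: z :: (P ++ R)) * listDet (c :: d :: (P ++ R))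
    - listDet (a :: c :: (P ++ R)) * listDet (z :: d :: (P ++ R))) * hs

/-- Plücker again, arranged as the quotient-rule numerator for a flow that replaces the first moving
vector `c` by `b`. -/
lemma listDet_exchange_left (P R : List (Fin n → ℂ)) (a b c d : Fin n → ℂ)
    (hP : P.length = R.length + 2) (hn : 2 * P.length = n) :
    listDet (a :: P ++ b :: R) * listDet (P ++ (c :: R ++ [d]))
      - listDet (a :: P ++ c :: R) * listDet (P ++ (b :: R ++ [d])) =
      -(listDet (a :: P ++ (R ++ [d])) * listDet (P ++ b :: c :: R)) := by
  have e₁ : ∀ x, listDet (a :: P ++ x :: R) = (-1) ^ P.length * listDet (a :: x :: (P ++ R)) :=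
    fun x => listDet_cons_middle P R x a (by omega)
  have e₂ : ∀ x, listDet (P ++ x :: (R ++ [d])) =
      (-1) ^ P.length * listDet (x :: d :: (P ++ R)) := by
    intro x
    rw [listDet_middle P (R ++ [d]) x (by simp; omega), ← List.append_assoc,
      listDet_cons_middle (P ++ R) [] d x (by simp; omega), List.append_nil, List.length_append,
      hP, show R.length + 2 + R.length = 2 * (R.length + 1) by ring, pow_mul]
    norm_num
  have e₃ : listDet (a :: P ++ (R ++ [d])) = listDet (a :: d :: (P ++ R)) := by
    have h := listDet_cons_middle (P ++ R) [] d a (by simp; omega)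
    rw [List.append_nil, List.length_append, hP,
      show R.length + 2 + R.length = 2 * (R.length + 1) by ring, pow_mul] at h
    simpa using h
  have e₄ : listDet (P ++ b :: c :: R) = listDet (b :: c :: (P ++ R)) := by
    rw [listDet_middle P (c :: R) b (by simp; omega), listDet_cons_middle P R c b (by omega),
      ← mul_assoc, ← mul_pow]
    norm_num
  have hs : ((-1 : ℂ) ^ P.length) * (-1) ^ P.length = 1 := by rw [← mul_pow]; norm_num
  have h := listDet_pluecker (P ++ R) a b c d (by simp; omega)
  simp only [List.cons_append] at e₁ e₃ ⊢
  rw [e₁, e₁, e₂, e₂, e₃, e₄]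
  linear_combination h + (listDet (a :: b :: (P ++ R)) * listDet (c :: d :: (P ++ R))
    - listDet (a :: c :: (P ++ R)) * listDet (b :: d :: (P ++ R))) * hs

/-- The counterpart for a flow that replaces the last moving vector `c` by `d`. -/
lemma listDet_exchange_right (P R : List (Fin n → ℂ)) (a b c d : Fin n → ℂ)
    (hP : P.length = R.length + 2) (hn : 2 * P.length = n) :
    listDet (P ++ a :: (R ++ [d])) * listDet (P ++ b :: (R ++ [c]))
      - listDet (P ++ a :: (R ++ [c])) * listDet (P ++ b :: (R ++ [d])) =
      -(listDet (P ++ a :: b :: R) * listDet (P ++ (R ++ [c, d]))) := by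
  have hpar : ((-1 : ℂ) ^ (P ++ R).length) = 1 := by
    rw [List.length_append, hP, show R.length + 2 + R.length = 2 * (R.length + 1) by ring, pow_mul]
    norm_num
  have e₁ : ∀ x y, listDet (P ++ x :: (R ++ [y])) =
      (-1) ^ P.length * listDet (x :: y :: (P ++ R)) := by
    intro x y
    rw [listDet_middle P (R ++ [y]) x (by simp; omega), ← List.append_assoc,
      listDet_cons_middle (P ++ R) [] y x (by simp; omega), List.append_nil, hpar]
    norm_num
  have e₂ : listDet (P ++ a :: b :: R) = listDet (a :: b :: (P ++ R)) := by
    rw [listDet_middle P (b :: R) a (by simp; omega), listDet_cons_middle P R b a (by omega),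
      ← mul_assoc, ← mul_pow]
    norm_num
  have e₃ : listDet (P ++ (R ++ [c, d])) = listDet (c :: d :: (P ++ R)) := by
    rw [← List.append_assoc, listDet_middle (P ++ R) [d] c (by simp; omega),
      listDet_cons_middle (P ++ R) [] d c (by simp; omega), List.append_nil, hpar]
    norm_num
  have hs : ((-1 : ℂ) ^ P.length) * (-1) ^ P.length = 1 := by rw [← mul_pow]; norm_num
  have h := listDet_pluecker (P ++ R) a b c d (by simp; omega)
  rw [e₁, e₁, e₁, e₁, e₂, e₃]
  linear_combination h + (listDet (a :: d :: (P ++ R)) * listDet (b :: c :: (P ++ R))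
    - listDet (a :: c :: (P ++ R)) * listDet (b :: d :: (P ++ R))) * hs

/-- The determinant with rows `p 0, …, p (k-1), r 0, …, r (n-k-1)`. -/
def blockDet (k : ℕ) (p r : ℕ → Fin n → ℂ) : ℂ :=
  Matrix.det (Matrix.of fun j : Fin n => if (j : ℕ) < k then p j else r (j - k))

lemma blockDet_eq_listDet {k l : ℕ} (hkl : k + l = n) (p r : ℕ → Fin n → ℂ) :
    blockDet k p r = listDet ((List.range k).map p ++ (List.range l).map r) := by
  unfold blockDet listDet
  congr 1
  ext j i
  have hj := j.2
  simp only [Matrix.of_apply, List.getD_eq_getElem?_getD]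
  split_ifs with h
  · rw [List.getElem?_append_left (by simpa using h)]
    simp [h]
  · rw [List.getElem?_append_right (by simpa using h)]
    have : (j : ℕ) - k < l := by omega
    simp [this]

/-- The determinant with rows `B^a u, …, B^(a+k-1) u, B^b v, …, B^(b+n-k-1) v`. -/
def krylovDet (B : Matrix (Fin n) (Fin n) ℂ) (u v : Fin n → ℂ) (k a b : ℕ) : ℂ :=
  blockDet k (fun j => B ^ (a + j) *ᵥ u) (fun j => B ^ (b + j) *ᵥ v)

/-- The list `B^a u, …, B^(a+k-1) u`. -/
def krylov (B : Matrix (Fin n) (Fin n) ℂ) (u : Fin n → ℂ) (a k : ℕ) : List (Fin n → ℂ) :=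
  (List.range' a k).map fun j => B ^ j *ᵥ u

variable (B : Matrix (Fin n) (Fin n) ℂ) (u v : Fin n → ℂ)

@[simp] lemma length_krylov (a k : ℕ) : (krylov B u a k).length = k := by simp [krylov]

lemma krylov_succ (a k : ℕ) : krylov B u a (k + 1) = B ^ a *ᵥ u :: krylov B u (a + 1) k := by
  simp [krylov, List.range'_succ]

lemma krylov_succ' (a k : ℕ) : krylov B u a (k + 1) = krylov B u a k ++ [B ^ (a + k) *ᵥ u] := by
  simp [krylov, List.range'_1_concat]

lemma krylov_eq_map_range (a k : ℕ) :
    krylov B u a k = (List.range k).map fun j => B ^ (a + j) *ᵥ u := by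
  simp [krylov, List.range'_eq_map_range, Function.comp_def]

lemma krylov_add_one (a k : ℕ) : krylov B u (a + 1) k = (krylov B u a k).map (B *ᵥ ·) := by
  simp [krylov_eq_map_range, Function.comp_def, ← pow_succ', add_right_comm]

lemma krylovDet_eq_listDet {k l : ℕ} (hkl : k + l = n) (a b : ℕ) :
    krylovDet B u v k a b = listDet (krylov B u a k ++ krylov B v b l) := by
  rw [krylovDet, blockDet_eq_listDet hkl, krylov_eq_map_range, krylov_eq_map_range]

lemma krylovDet_succ_succ {k : ℕ} (hk : k ≤ n) (a b : ℕ) :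
    krylovDet B u v k (a + 1) (b + 1) = B.det * krylovDet B u v k a b := by
  obtain ⟨l, hl⟩ := Nat.exists_eq_add_of_le hk
  rw [krylovDet_eq_listDet B u v hl.symm, krylovDet_eq_listDet B u v hl.symm, krylov_add_one,
    krylov_add_one, ← List.map_append, listDet_map_mulVec]

/-- Interchange of the two blocks when `B = δ S²`. -/
lemma krylovDet_reverse (S : Matrix (Fin n) (Fin n) ℂ) (δ : ℂ) (hB : B = δ • S ^ 2) {k l : ℕ}
    (hkl : k + l = n) (a b : ℕ) :
    krylovDet B v (S *ᵥ u) k (a + 1) b =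
      (-1) ^ (k * l) * S.det * δ ^ k * krylovDet B u (S *ᵥ v) l b a := by
  have hS : Commute S B := by
    rw [hB]; exact ((Commute.refl S).pow_right 2).smul_right δ
  -- One factor `B = δ S²` is split: `B^(a+1+j) v = S (δ B^(a+j) S v)`. This is why the exponent on
  -- the left has to be positive.
  have h₁ : krylov B v (a + 1) k = ((krylov B (S *ᵥ v) a k).map (δ • ·)).map (S *ᵥ ·) := by
    rw [krylov_add_one]
    simp only [krylov_eq_map_range, List.map_map]
    refine List.map_congr_left fun j _ => ?_
    simp only [Function.comp, Matrix.mulVec_smul, Matrix.mulVec_mulVec]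
    rw [← mul_assoc, (hS.pow_right (a + j)).eq, mul_assoc, ← pow_two, ← Matrix.smul_mulVec,
      ← mul_smul_comm, ← hB, ← pow_succ', ← pow_succ]
  have h₂ : krylov B (S *ᵥ u) b l = (krylov B u b l).map (S *ᵥ ·) := by
    simp only [krylov_eq_map_range, List.map_map]
    refine List.map_congr_left fun j _ => ?_
    simp only [Function.comp, Matrix.mulVec_mulVec]
    rw [(hS.pow_right (b + j)).eq]
  rw [krylovDet_eq_listDet _ _ _ hkl, krylovDet_eq_listDet B u (S *ᵥ v) ((add_comm l k).trans hkl),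
    h₁, h₂, ← List.map_append, listDet_map_mulVec, listDet_append_comm _ _ (by simpa using hkl),
    listDet_append_map_smul _ _ _ (by simp; omega)]
  simp only [List.length_map, length_krylov]
  ring

end BlockDeterminants

/-! ### The bilinear identity behind both equations. -/

section Bilinear

variable {m : ℕ} (B : Matrix (Fin (2 * (m + 1))) (Fin (2 * (m + 1))) ℂ)
  (u v : Fin (2 * (m + 1)) → ℂ)

lemma krylovDet_bilinear (a b : ℕ) :
    krylovDet B u v (m + 2) a (b + 1) * krylovDet B u v m (a + 1) b
      - krylovDet B u v (m + 1) a b * krylovDet B u v (m + 1) (a + 1) (b + 1)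
      + krylovDet B u v (m + 1) a (b + 1) * krylovDet B u v (m + 1) (a + 1) b = 0 := by
  have h := listDet_outer_inner (krylov B u (a + 1) m) (krylov B v (b + 1) m) (B ^ a *ᵥ u)
    (B ^ (a + 1 + m) *ᵥ u) (B ^ b *ᵥ v) (B ^ (b + 1 + m) *ᵥ v) (by simp) (by simp; omega)
  rw [krylovDet_eq_listDet B u v (by omega : (m + 2) + m = _),
    krylovDet_eq_listDet B u v (by omega : m + (m + 2) = _),
    krylovDet_eq_listDet B u v (by omega : (m + 1) + (m + 1) = _),
    krylovDet_eq_listDet B u v (by omega : (m + 1) + (m + 1) = _),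
    krylovDet_eq_listDet B u v (by omega : (m + 1) + (m + 1) = _),
    krylovDet_eq_listDet B u v (by omega : (m + 1) + (m + 1) = _)]
  simpa [krylov_succ B u a, krylov_succ' B u (a + 1), krylov_succ B v b, krylov_succ' B v (b + 1)]
    using h

end Bilinear

/-! ### Differentiating determinants along the flows of `B` and its inverse. -/

section Derivatives

variable {n : ℕ}

lemma hasDerivAt_det {M : ℝ → Matrix (Fin n) (Fin n) ℂ} {M' : Matrix (Fin n) (Fin n) ℂ} {t : ℝ}
    (hM : ∀ i j, HasDerivAt (fun τ => M τ i j) (M' i j) t) :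
    HasDerivAt (fun τ => (M τ).det) (∑ j, ((M t).updateRow j (M' j)).det) t := by
  have h : HasDerivAt (fun τ => ∑ σ : Equiv.Perm (Fin n), ((Equiv.Perm.sign σ : ℤ) : ℂ) *
      ∏ i, M τ i (σ i)) (∑ σ : Equiv.Perm (Fin n), ((Equiv.Perm.sign σ : ℤ) : ℂ) *
      ∑ i, (∏ j ∈ Finset.univ.erase i, M t j (σ j)) • M' i (σ i)) t :=
    HasDerivAt.fun_sum fun σ _ =>
      (HasDerivAt.fun_finsetProd fun i _ => hM i (σ i)).const_mul _
  -- The transposed Leibniz formula indexes the factors by rows, so differentiating one factor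
  -- amounts to `updateRow`.
  have e : ∀ L : Matrix (Fin n) (Fin n) ℂ, L.det =
      ∑ σ : Equiv.Perm (Fin n), ((Equiv.Perm.sign σ : ℤ) : ℂ) * ∏ i, L i (σ i) := by
    intro L
    rw [← Matrix.det_transpose, Matrix.det_apply']
    rfl
  simp only [e]
  refine h.congr_deriv ?_
  simp only [Finset.mul_sum]
  rw [Finset.sum_comm]
  refine Finset.sum_congr rfl fun j _ => Finset.sum_congr rfl fun σ _ => ?_
  rw [← Finset.prod_erase_mul _ _ (Finset.mem_univ j), Matrix.updateRow_self, smul_eq_mul]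
  congr 2
  refine Finset.prod_congr rfl fun i hi => ?_
  rw [Matrix.updateRow_ne (Finset.ne_of_mem_erase hi)]

/-- If all but one of the derivatives of the moving rows are multiples of other moving rows,
the derivative of the determinant consists of a single term. -/
lemma hasDerivAt_blockDet {k l : ℕ} (hkl : k + l = n) (p : ℕ → Fin n → ℂ)
    {r : ℝ → ℕ → Fin n → ℂ} {r' : ℕ → Fin n → ℂ} {t : ℝ}
    (hr : ∀ j i, HasDerivAt (fun τ => r τ j i) (r' j i) t) {j₀ : ℕ} (hj₀ : j₀ < l)
    (hz : ∀ j < l, j ≠ j₀ → ∃ i < l, i ≠ j ∧ ∃ c : ℂ, r' j = c • r t i) :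
    HasDerivAt (fun τ => blockDet k p (r τ))
      (blockDet k p (Function.update (r t) j₀ (r' j₀))) t := by
  have h := hasDerivAt_det (t := t)
    (M := fun τ => Matrix.of fun j : Fin n => if (j : ℕ) < k then p j else r τ (j - k))
    (M' := Matrix.of fun j : Fin n => if (j : ℕ) < k then 0 else r' (j - k)) (by
      intro j i
      simp only [Matrix.of_apply]
      split_ifs
      · exact hasDerivAt_const _ _
      · exact hr _ _)
  refine h.congr_deriv ?_
  rw [Finset.sum_eq_single (⟨k + j₀, by omega⟩ : Fin n)]
  · unfold blockDet
    congr 1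
    ext j i
    by_cases hj : j = ⟨k + j₀, by omega⟩
    · subst hj; simp
    · rw [Matrix.updateRow_ne hj]
      simp only [Matrix.of_apply]
      split_ifs with hjk
      · rfl
      · rw [Function.update_of_ne]
        intro e
        exact hj (Fin.ext (by simp; omega))
  · intro j _ hj
    by_cases hjk : (j : ℕ) < k
    · refine Matrix.det_eq_zero_of_row_eq_zero j fun i => ?_
      simp [hjk]
    · have hjn := j.2
      obtain ⟨i, hi, hij, c, hc⟩ := hz (j - k) (by omega) (fun e => hj (Fin.ext (by simp; omega)))
      have e : (Matrix.of fun j : Fin n => if (j : ℕ) < k then 0 else r' (j - k)) j =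
          c • r t i := by
        ext
        simp [hjk, hc]
      have hne : (⟨k + i, by omega⟩ : Fin n) ≠ j := fun e => hij (by rw [← e]; simp)
      rw [e, Matrix.det_updateRow_smul, Matrix.det_zero_of_row_eq hne, mul_zero]
      rw [Matrix.updateRow_ne hne, Matrix.updateRow_self]
      ext
      simp
  · simp

lemma hasDerivAt_exp_mulVec (X M : Matrix (Fin n) (Fin n) ℂ) (v : Fin n → ℂ) (i : Fin n) :
    HasDerivAt (fun τ : ℝ => (M *ᵥ (NormedSpace.exp (τ • X) *ᵥ v)) i) ((M *ᵥ (X *ᵥ v)) i) 0 := by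
  open scoped Matrix.Norms.Operator in
  have h := hasDerivAt_exp_smul_const (𝕂 := ℝ) X 0
  rw [zero_smul, NormedSpace.exp_zero, one_mul] at h
  let l : Matrix (Fin n) (Fin n) ℂ →ₗ[ℝ] ℂ :=
    { toFun := fun Y => (M *ᵥ (Y *ᵥ v)) i
      map_add' := fun Y Z => by simp [Matrix.add_mulVec, Matrix.mulVec_add]
      map_smul' := fun c Y => by simp [Matrix.smul_mulVec, Matrix.mulVec_smul] }
  exact (LinearMap.toContinuousLinearMap l).hasFDerivAt.comp_hasDerivAt 0 h

lemma blockDet_smul_update {k l : ℕ} (hkl : k + l = n) (p r : ℕ → Fin n → ℂ) {j₀ : ℕ}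
    (hj₀ : j₀ < l) (c : ℂ) (w : Fin n → ℂ) :
    blockDet k p (Function.update r j₀ (c • w)) = c * blockDet k p (Function.update r j₀ w) := by
  have e : ∀ x, blockDet k p (Function.update r j₀ x) = Matrix.det (Matrix.updateRow
      (Matrix.of fun j : Fin n => if (j : ℕ) < k then p j else r (j - k)) ⟨k + j₀, by omega⟩ x) := by
    intro x
    unfold blockDet
    congr 1
    ext j i
    by_cases hj : j = ⟨k + j₀, by omega⟩
    · subst hj; simp
    · rw [Matrix.updateRow_ne hj]
      simp only [Matrix.of_apply]
      split_ifs with hjk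
      · rfl
      · rw [Function.update_of_ne]
        intro e
        exact hj (Fin.ext (by simp; omega))
  rw [e, e, Matrix.det_updateRow_smul]

variable (B : Matrix (Fin n) (Fin n) ℂ) (u v : Fin n → ℂ)

/-- The moving block is empty. This is needed for `N = 1`, where the numerators of both ratios have
no `v` column. -/
lemma hasDerivAt_krylovDet_zero {k : ℕ} (hk : k = n) (a b : ℕ) (X : Matrix (Fin n) (Fin n) ℂ) :
    HasDerivAt (fun τ : ℝ => krylovDet B u (NormedSpace.exp (τ • X) *ᵥ v) k a b) 0 0 := by
  have e : (fun τ : ℝ => krylovDet B u (NormedSpace.exp (τ • X) *ᵥ v) k a b) =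
      fun _ => krylovDet B u v k a b := by
    funext τ
    rw [krylovDet_eq_listDet _ _ _ (by omega : k + 0 = n),
      krylovDet_eq_listDet _ _ _ (by omega : k + 0 = n)]
    simp [krylov]
  rw [e]
  exact hasDerivAt_const _ _

/-- The derivative of each moving row is `c` times the next one, so only the last row contributes.
-/
lemma hasDerivAt_krylovDet_up {k l : ℕ} (hkl : k + (l + 1) = n) (a b : ℕ) (c : ℂ) :
    HasDerivAt (fun τ : ℝ => krylovDet B u (NormedSpace.exp (τ • (c • B)) *ᵥ v) k a b)
      (c * listDet (krylov B u a k ++ (krylov B v b l ++ [B ^ (b + l + 1) *ᵥ v]))) 0 := by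
  have h := hasDerivAt_blockDet hkl (fun j => B ^ (a + j) *ᵥ u)
    (r := fun τ j => B ^ (b + j) *ᵥ (NormedSpace.exp (τ • (c • B)) *ᵥ v))
    (r' := fun j => c • B ^ (b + j + 1) *ᵥ v) (t := 0) (j₀ := l)
    (fun j i => by
      refine (hasDerivAt_exp_mulVec (c • B) (B ^ (b + j)) v i).congr_deriv ?_
      rw [Matrix.smul_mulVec, Matrix.mulVec_smul, Matrix.mulVec_mulVec, ← pow_succ])
    (Nat.lt_succ_self l)
    (fun j hj hjl => ⟨j + 1, by omega, by omega, c, by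
      simp [NormedSpace.exp_zero, add_assoc]⟩)
  refine h.congr_deriv ?_
  rw [blockDet_smul_update hkl _ _ (Nat.lt_succ_self l), blockDet_eq_listDet hkl,
    krylov_eq_map_range, krylov_eq_map_range, List.range_succ, List.map_append]
  congr 4
  · refine List.map_congr_left fun j hj => ?_
    rw [Function.update_of_ne (by simp at hj; omega)]
    simp [NormedSpace.exp_zero]
  · simp

/-- The derivative of each moving row is `c` times the previous one, so only the first row
contributes. Starting the block at `b + 1` keeps the lowered exponent a natural number. -/
lemma hasDerivAt_krylovDet_down {K : Matrix (Fin n) (Fin n) ℂ} (hK : B * K = 1) {k l : ℕ}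
    (hkl : k + (l + 1) = n) (a b : ℕ) (c : ℂ) :
    HasDerivAt (fun τ : ℝ => krylovDet B u (NormedSpace.exp (τ • (c • K)) *ᵥ v) k a (b + 1))
      (c * listDet (krylov B u a k ++ (B ^ b *ᵥ v) :: krylov B v (b + 2) l)) 0 := by
  have h := hasDerivAt_blockDet hkl (fun j => B ^ (a + j) *ᵥ u)
    (r := fun τ j => B ^ (b + 1 + j) *ᵥ (NormedSpace.exp (τ • (c • K)) *ᵥ v))
    (r' := fun j => c • B ^ (b + j) *ᵥ v) (t := 0) (j₀ := 0)
    (fun j i => by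
      refine (hasDerivAt_exp_mulVec (c • K) (B ^ (b + 1 + j)) v i).congr_deriv ?_
      rw [Matrix.smul_mulVec, Matrix.mulVec_smul, Matrix.mulVec_mulVec,
        add_right_comm, pow_succ, mul_assoc, hK, mul_one])
    (Nat.succ_pos l)
    (fun j hj hjl => ⟨j - 1, by omega, by omega, c, by
      rw [show b + 1 + (j - 1) = b + j by omega]
      simp [NormedSpace.exp_zero]⟩)
  refine h.congr_deriv ?_
  rw [blockDet_smul_update hkl _ _ (Nat.succ_pos l), blockDet_eq_listDet hkl,
    krylov_eq_map_range, krylov_eq_map_range, List.range_succ_eq_map, List.map_cons, List.map_map]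
  congr 4
  refine List.map_congr_left fun j hj => ?_
  simp only [Function.comp]
  rw [Function.update_of_ne (by simp)]
  rw [show b + 2 + j = b + 1 + (j + 1) by omega]
  simp [NormedSpace.exp_zero]

end Derivatives

/-! ### Derivatives of the two ratios of determinants. -/

section Ratios

variable {m : ℕ} (B : Matrix (Fin (2 * (m + 1))) (Fin (2 * (m + 1))) ℂ)
  (u v : Fin (2 * (m + 1)) → ℂ)

lemma hasDerivAt_ratio_up (c : ℂ) (h₀ : krylovDet B u v (m + 1) 0 0 ≠ 0) :
    HasDerivAt (fun τ : ℝ => krylovDet B u (NormedSpace.exp (τ • (c • B)) *ᵥ v) (m + 2) 0 1 /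
        krylovDet B u (NormedSpace.exp (τ • (c • B)) *ᵥ v) (m + 1) 0 0)
      (-c * krylovDet B u v (m + 2) 0 0 * krylovDet B u v (m + 1) 0 1 /
        krylovDet B u v (m + 1) 0 0 ^ 2) 0 := by
  have hd := hasDerivAt_krylovDet_up B u v (by omega : (m + 1) + (m + 1) = _) 0 0 c
  have e : NormedSpace.exp ((0 : ℝ) • (c • B)) *ᵥ v = v := by simp [NormedSpace.exp_zero]
  have eY : krylovDet B u v (m + 1) 0 1 = listDet (krylov B u 0 (m + 1) ++ krylov B v 1 (m + 1)) :=
    krylovDet_eq_listDet B u v (by omega) _ _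
  have eS : krylovDet B u v (m + 1) 0 0 = listDet (krylov B u 0 (m + 1) ++ krylov B v 0 (m + 1)) :=
    krylovDet_eq_listDet B u v (by omega) _ _
  rcases m with _ | m
  · have hn := hasDerivAt_krylovDet_zero B u v (by omega : 2 = _) 0 1 (c • B)
    refine (hn.div hd (by rwa [e])).congr_deriv ?_
    have eH : krylovDet B u v 2 0 1 = krylovDet B u v 2 0 0 := by
      rw [krylovDet_eq_listDet B u v (by omega : 2 + 0 = _),
        krylovDet_eq_listDet B u v (by omega : 2 + 0 = _)]
      simp [krylov]
    rw [e]
    simp only [Nat.zero_add, eH, eY]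
    simp only [krylov, List.range'_zero, List.map_nil, List.nil_append, List.range'_one,
      List.map_cons, List.cons_append, zero_mul, zero_sub]
    ring
  · have hn := hasDerivAt_krylovDet_up B u v (by omega : (m + 3) + (m + 1) = _) 0 1 c
    refine (hn.div hd (by rwa [e])).congr_deriv ?_
    have h := listDet_exchange_right (krylov B u 0 (m + 2)) (krylov B v 1 m) (B ^ (m + 2) *ᵥ u)
      (B ^ 0 *ᵥ v) (B ^ (m + 1) *ᵥ v) (B ^ (m + 2) *ᵥ v) (by simp) (by simp)
    rw [e, eS, eY, krylovDet_eq_listDet B u v (by omega : (m + 3) + (m + 1) = _),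
      krylovDet_eq_listDet B u v (by omega : (m + 3) + (m + 1) = _)]
    congr 1
    have e₁ : krylov B u 0 (m + 3) = krylov B u 0 (m + 2) ++ [B ^ (m + 2) *ᵥ u] := by
      rw [krylov_succ', zero_add]
    have e₂ : krylov B v 0 (m + 2) =
        B ^ 0 *ᵥ v :: (krylov B v 1 m ++ [B ^ (m + 1) *ᵥ v]) := by
      rw [krylov_succ, krylov_succ', zero_add, add_comm 1 m]
    have e₃ : krylov B v 0 (m + 1) = B ^ 0 *ᵥ v :: krylov B v 1 m := krylov_succ B v 0 m
    have e₄ : krylov B v 1 (m + 1) = krylov B v 1 m ++ [B ^ (m + 1) *ᵥ v] := by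
      rw [krylov_succ', add_comm 1 m]
    have e₅ : krylov B v 1 (m + 2) = krylov B v 1 m ++ [B ^ (m + 1) *ᵥ v, B ^ (m + 2) *ᵥ v] := by
      rw [krylov_succ', e₄, add_comm 1, List.append_assoc, List.singleton_append]
    rw [e₁, e₂, e₃, e₄, e₅, show 1 + m + 1 = m + 2 by omega, show 0 + (m + 1) + 1 = m + 2 by omega]
    simp only [List.append_assoc, List.cons_append, List.nil_append] at h ⊢
    linear_combination c * h

lemma hasDerivAt_ratio_down {K : Matrix (Fin (2 * (m + 1))) (Fin (2 * (m + 1))) ℂ}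
    (hK : B * K = 1) (c : ℂ) (h₀ : krylovDet B u v (m + 1) 1 0 ≠ 0) :
    HasDerivAt (fun τ : ℝ => krylovDet B u (NormedSpace.exp (τ • (c • K)) *ᵥ v) (m + 2) 0 0 /
        krylovDet B u (NormedSpace.exp (τ • (c • K)) *ᵥ v) (m + 1) 1 0)
      (-c * krylovDet B u v (m + 2) 0 1 * krylovDet B u v (m + 1) 2 0 /
        (B.det * krylovDet B u v (m + 1) 1 0 ^ 2)) 0 := by
  have hβ : B.det ≠ 0 := by
    intro h
    simpa [h] using congrArg Matrix.det hK
  -- Lowering needs positive exponents in the moving block, so all rows of numerator and denominator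
  -- are multiplied by `B`; the two factors `det B` cancel.
  have hfun : (fun τ : ℝ => krylovDet B u (NormedSpace.exp (τ • (c • K)) *ᵥ v) (m + 2) 0 0 /
        krylovDet B u (NormedSpace.exp (τ • (c • K)) *ᵥ v) (m + 1) 1 0) =
      fun τ : ℝ => krylovDet B u (NormedSpace.exp (τ • (c • K)) *ᵥ v) (m + 2) (0 + 1) (0 + 1) /
        krylovDet B u (NormedSpace.exp (τ • (c • K)) *ᵥ v) (m + 1) (1 + 1) (0 + 1) := by
    funext τ
    rw [krylovDet_succ_succ _ _ _ (by omega), krylovDet_succ_succ _ _ _ (by omega),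
      mul_div_mul_left _ _ hβ]
  rw [hfun]
  have eF := krylovDet_succ_succ B u v (by omega : m + 1 ≤ 2 * (m + 1)) 1 0
  have eG := krylovDet_succ_succ B u v (by omega : m + 2 ≤ 2 * (m + 1)) 0 1
  have hd := hasDerivAt_krylovDet_down B u v hK (by omega : (m + 1) + (m + 1) = _) 2 0 c
  have e : NormedSpace.exp ((0 : ℝ) • (c • K)) *ᵥ v = v := by simp [NormedSpace.exp_zero]
  have h₁ : krylovDet B u v (m + 1) (1 + 1) (0 + 1) ≠ 0 := by
    rw [eF]; exact mul_ne_zero hβ h₀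
  suffices hs : HasDerivAt (fun τ : ℝ =>
      krylovDet B u (NormedSpace.exp (τ • (c • K)) *ᵥ v) (m + 2) (0 + 1) (0 + 1) /
        krylovDet B u (NormedSpace.exp (τ • (c • K)) *ᵥ v) (m + 1) (1 + 1) (0 + 1))
      (-c * krylovDet B u v (m + 2) (0 + 1) (1 + 1) * krylovDet B u v (m + 1) 2 0 /
        krylovDet B u v (m + 1) (1 + 1) (0 + 1) ^ 2) 0 by
    refine hs.congr_deriv ?_
    rw [eF, eG]
    field_simp
  have eX : krylovDet B u v (m + 1) 2 0 = listDet (krylov B u 2 (m + 1) ++ krylov B v 0 (m + 1)) :=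
    krylovDet_eq_listDet B u v (by omega) _ _
  have eF' : krylovDet B u v (m + 1) (1 + 1) (0 + 1) =
      listDet (krylov B u 2 (m + 1) ++ krylov B v 1 (m + 1)) :=
    krylovDet_eq_listDet B u v (by omega) _ _
  rcases m with _ | m
  · have hn := hasDerivAt_krylovDet_zero B u v (by omega : 2 = _) (0 + 1) (0 + 1) (c • K)
    refine (hn.div hd (by rwa [e])).congr_deriv ?_
    have eH : krylovDet B u v 2 (0 + 1) (1 + 1) = krylovDet B u v 2 (0 + 1) (0 + 1) := by
      rw [krylovDet_eq_listDet B u v (by omega : 2 + 0 = _),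
        krylovDet_eq_listDet B u v (by omega : 2 + 0 = _)]
      simp [krylov]
    rw [e]
    simp only [Nat.zero_add] at eH eX ⊢
    rw [eH, eX]
    simp only [krylov, List.range'_zero, List.map_nil, List.range'_one, List.map_cons,
      List.cons_append, List.nil_append, zero_mul, zero_sub]
    ring
  · have hn := hasDerivAt_krylovDet_down B u v hK (by omega : (m + 3) + (m + 1) = _) 1 0 c
    refine (hn.div hd (by rwa [e])).congr_deriv ?_
    have h := listDet_exchange_left (krylov B u 2 (m + 2)) (krylov B v 2 m) (B ^ 1 *ᵥ u)
      (B ^ 0 *ᵥ v) (B ^ 1 *ᵥ v) (B ^ (2 + m) *ᵥ v) (by simp) (by simp)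
    rw [e, eF', eX, krylovDet_eq_listDet B u v (by omega : (m + 3) + (m + 1) = _),
      krylovDet_eq_listDet B u v (by omega : (m + 3) + (m + 1) = _)]
    congr 1
    have e₁ : krylov B u 1 (m + 3) = B ^ 1 *ᵥ u :: krylov B u 2 (m + 2) := krylov_succ B u 1 _
    have e₂ : krylov B v 1 (m + 2) =
        B ^ 1 *ᵥ v :: (krylov B v 2 m ++ [B ^ (2 + m) *ᵥ v]) := by
      rw [krylov_succ, krylov_succ']
    have e₃ : krylov B v 2 (m + 1) = krylov B v 2 m ++ [B ^ (2 + m) *ᵥ v] := krylov_succ' B v 2 m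
    have e₄ : krylov B v 1 (m + 1) = B ^ 1 *ᵥ v :: krylov B v 2 m := krylov_succ B v 1 m
    have e₅ : krylov B v 0 (m + 2) = B ^ 0 *ᵥ v :: B ^ 1 *ᵥ v :: krylov B v 2 m := by
      rw [krylov_succ, krylov_succ]
    simp only [zero_add, one_add_one_eq_two]
    rw [e₁, e₂, e₃, e₄, e₅]
    simp only [List.cons_append] at h ⊢
    linear_combination c * h

end Ratios

/-! ### The vector `φ` as a two-parameter flow, and smoothness. -/

section Phi

variable {n : ℕ}

lemma iteratedDeriv_of_flow {X : Matrix (Fin n) (Fin n) ℂ} {w : ℝ → Fin n → ℂ}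
    (hw : ∀ x y, w y = NormedSpace.exp ((y - x) • X) *ᵥ w x) (j : ℕ) (x : ℝ) :
    iteratedDeriv j w x = X ^ j *ᵥ w x := by
  induction j generalizing x with
  | zero => simp
  | succ j ih =>
    rw [iteratedDeriv_succ, funext ih]
    refine HasDerivAt.deriv (hasDerivAt_pi.2 fun i => ?_)
    have h := (hasDerivAt_exp_mulVec X (X ^ j) (w x) i)
    -- Writing the base point `0` as `x - x` lets a translation carry the derivative of the
    -- exponential at `0` to `x`.
    rw [← sub_self x] at h
    have h' := HasDerivAt.comp_sub_const x x h
    simp only [← hw] at h'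
    rwa [pow_succ, ← Matrix.mulVec_mulVec]

variable (A : Matrix (Fin n) (Fin n) ℂ) (C : Fin n → ℂ)

lemma phi_eq (x t : ℝ) : phi A C x t =
    NormedSpace.exp (x • ((Complex.I / 2) • A ^ 2) + t • ((Complex.I / 2) • (A ^ 2)⁻¹)) *ᵥ C := by
  rw [phi]
  congr 3 <;> · rw [mul_comm, mul_smul]; exact Complex.coe_smul _ _

variable {A} in
lemma commute_sq_inv (hA : IsUnit A) : Commute (A ^ 2) (A ^ 2)⁻¹ := by
  have h : IsUnit (A ^ 2).det := (Matrix.isUnit_iff_isUnit_det _).1 (hA.pow 2)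
  rw [Commute, SemiconjBy, Matrix.mul_nonsing_inv _ h, Matrix.nonsing_inv_mul _ h]

variable {A}

lemma phi_add_left (hA : IsUnit A) (x y t : ℝ) :
    phi A C y t = NormedSpace.exp ((y - x) • ((Complex.I / 2) • A ^ 2)) *ᵥ phi A C x t := by
  rw [phi_eq, phi_eq, Matrix.mulVec_mulVec, ← Matrix.exp_add_of_commute]
  · congr 2
    rw [sub_smul]; abel
  · refine Commute.add_right ?_ ?_
    · exact (((Commute.refl _).smul_right _).smul_left _)
    · exact ((((commute_sq_inv hA).smul_right _).smul_left _).smul_right _).smul_left _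

lemma phi_add_right (hA : IsUnit A) (x t t' : ℝ) :
    phi A C x t' = NormedSpace.exp ((t' - t) • ((Complex.I / 2) • (A ^ 2)⁻¹)) *ᵥ phi A C x t := by
  rw [phi_eq, phi_eq, Matrix.mulVec_mulVec, ← Matrix.exp_add_of_commute]
  · congr 2
    rw [sub_smul]; abel
  · refine Commute.add_right ?_ ?_
    · exact ((((commute_sq_inv hA).symm.smul_right _).smul_left _).smul_right _).smul_left _
    · exact (((Commute.refl _).smul_right _).smul_left _)

variable (A) in
lemma contDiff_phi (i : Fin n) : ContDiff ℝ ∞ fun p : ℝ × ℝ => phi A C p.1 p.2 i := by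
  open scoped Matrix.Norms.Operator in
  have hexp : ContDiff ℝ ∞ (NormedSpace.exp : Matrix (Fin n) (Fin n) ℂ → _) :=
    contDiff_iff_contDiffAt.2 fun x => (NormedSpace.exp_analytic (𝕂 := ℝ) x).contDiffAt
  let l : Matrix (Fin n) (Fin n) ℂ →ₗ[ℝ] ℂ :=
    { toFun := fun Y => (Y *ᵥ C) i
      map_add' := fun Y Z => by simp [Matrix.add_mulVec]
      map_smul' := fun c Y => by simp [Matrix.smul_mulVec] }
  simp only [phi_eq]
  refine (LinearMap.toContinuousLinearMap l).contDiff.comp (hexp.comp ?_)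
  exact (contDiff_fst.smul contDiff_const).add (contDiff_snd.smul contDiff_const)

lemma contDiff_krylovDet {B : Matrix (Fin n) (Fin n) ℂ} {u v : ℝ × ℝ → Fin n → ℂ}
    (hu : ∀ i, ContDiff ℝ ∞ fun p => u p i) (hv : ∀ i, ContDiff ℝ ∞ fun p => v p i) (k a b : ℕ) :
    ContDiff ℝ ∞ fun p => krylovDet B (u p) (v p) k a b := by
  have hmul : ∀ (M : Matrix (Fin n) (Fin n) ℂ) (w : ℝ × ℝ → Fin n → ℂ),
      (∀ i, ContDiff ℝ ∞ fun p => w p i) → ∀ i, ContDiff ℝ ∞ fun p => (M *ᵥ w p) i := by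
    intro M w hw i
    simp only [Matrix.mulVec, dotProduct]
    exact ContDiff.sum fun j _ => contDiff_const.mul (hw j)
  simp only [krylovDet, blockDet, Matrix.det_apply']
  refine ContDiff.sum fun σ _ => contDiff_const.mul (contDiff_prod fun i _ => ?_)
  simp only [Matrix.of_apply]
  split_ifs
  · exact hmul _ _ hu _
  · exact hmul _ _ hv _

lemma krylovDet_mulVec_mulVec {B E : Matrix (Fin n) (Fin n) ℂ} (hE : Commute E B)
    (u v : Fin n → ℂ) {k : ℕ} (hk : k ≤ n) (a b : ℕ) :
    krylovDet B (E *ᵥ u) (E *ᵥ v) k a b = E.det * krylovDet B u v k a b := by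
  obtain ⟨l, hl⟩ := Nat.exists_eq_add_of_le hk
  have h : ∀ (w : Fin n → ℂ) (c j : ℕ),
      krylov B (E *ᵥ w) c j = (krylov B w c j).map (E *ᵥ ·) := by
    intro w c j
    simp only [krylov_eq_map_range, List.map_map]
    refine List.map_congr_left fun i _ => ?_
    simp only [Function.comp, Matrix.mulVec_mulVec]
    rw [(hE.pow_right (c + i)).eq]
  rw [krylovDet_eq_listDet _ _ _ hl.symm, krylovDet_eq_listDet _ _ _ hl.symm, h, h,
    ← List.map_append, listDet_map_mulVec]

lemma det_exp_ne_zero (Y : Matrix (Fin n) (Fin n) ℂ) : (NormedSpace.exp Y).det ≠ 0 :=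
  ((Matrix.isUnit_iff_isUnit_det _).1 (Matrix.isUnit_exp Y)).ne_zero

/-- Moving both vectors along opposite flows amounts, up to a common factor, to moving the second
one only. -/
lemma krylovDet_flow {B S X : Matrix (Fin n) (Fin n) ℂ} (hXB : Commute X B) (hXS : Commute X S)
    (u v : Fin n → ℂ) (τ : ℝ) {k : ℕ} (hk : k ≤ n) (a b : ℕ) :
    krylovDet B (NormedSpace.exp (τ • ((Complex.I / 2) • X)) *ᵥ u)
        (S *ᵥ (NormedSpace.exp (-(τ • ((Complex.I / 2) • X))) *ᵥ v)) k a b =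
      (NormedSpace.exp (τ • ((Complex.I / 2) • X))).det *
        krylovDet B u (NormedSpace.exp (τ • ((-Complex.I) • X)) *ᵥ (S *ᵥ v)) k a b := by
  open scoped Matrix.Norms.Operator in
  have hEB : Commute (NormedSpace.exp (τ • ((Complex.I / 2) • X))) B :=
    ((hXB.smul_left _).smul_left _).exp_left
  have hES : Commute (NormedSpace.exp (-(τ • ((Complex.I / 2) • X)))) S :=
    ((hXS.smul_left _).smul_left _).neg_left.exp_left
  -- With `E = exp(τ (i/2) X)`, the point is that `E * exp(-iτX) = E⁻¹`; hence `-i` in place of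
  -- `-i/2`.
  rw [← krylovDet_mulVec_mulVec hEB _ _ hk, Matrix.mulVec_mulVec _ S, ← hES.eq,
    Matrix.mulVec_mulVec, Matrix.mulVec_mulVec, ← Matrix.exp_add_of_commute]
  · congr 4
    rw [← smul_neg, ← smul_add]
    congr 1
    module
  · exact ((((Commute.refl X).smul_right _).smul_right _).smul_left _).smul_left _

end Phi

/-! ### From Wronskian columns to powers of `A ^ 2`. -/

section Determinants

variable {N : ℕ} (A S : Matrix (Fin (2 * N)) (Fin (2 * N)) ℂ) (C : Fin (2 * N) → ℂ)

variable {A S} in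
-- The `j`-th `x`-derivative is `(i/2)^j B^j` on `φ(x,t)` and `(-i/2)^j B^j` on `φ(-x,-t)`; the
-- scalars come out column by column.
lemma phiDet_eq (hA : IsUnit A) (hS : Commute S (A ^ 2)) {k l : ℕ} (hkl : k + l = 2 * N)
    (a b : ℕ) (x t : ℝ) :
    phiDet A C k ((A ^ 2) ^ a) ((A ^ 2) ^ b * S) x t =
      (∏ j ∈ Finset.range k, (Complex.I / 2) ^ j) * (∏ j ∈ Finset.range l, (-(Complex.I / 2)) ^ j) *
        krylovDet (A ^ 2) (phi A C x t) (S *ᵥ phi A C (-x) (-t)) k a b := by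
  have h₁ : ∀ j, iteratedDeriv j (fun y => phi A C y t) x =
      ((Complex.I / 2) • A ^ 2) ^ j *ᵥ phi A C x t := fun j =>
    iteratedDeriv_of_flow (w := fun y => phi A C y t) (fun x y => phi_add_left C hA x y t) j x
  have h₂ : ∀ j, iteratedDeriv j (fun y => phi A C (-y) (-t)) x =
      ((-(Complex.I / 2)) • A ^ 2) ^ j *ᵥ phi A C (-x) (-t) := fun j =>
    iteratedDeriv_of_flow (w := fun y => phi A C (-y) (-t)) (fun x y => by
      rw [phi_add_left C hA (-x) (-y) (-t), neg_smul, smul_neg, ← neg_smul]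
      congr 4
      ring) j x
  have hprod : ∏ j : Fin (2 * N), (if (j : ℕ) < k then (Complex.I / 2) ^ (j : ℕ)
      else (-(Complex.I / 2)) ^ ((j : ℕ) - k)) =
      (∏ j ∈ Finset.range k, (Complex.I / 2) ^ j) *
        (∏ j ∈ Finset.range l, (-(Complex.I / 2)) ^ j) := by
    rw [Fin.prod_univ_eq_prod_range (fun j => if j < k then (Complex.I / 2) ^ j
      else (-(Complex.I / 2)) ^ (j - k)) (2 * N), ← hkl, Finset.prod_range_add]
    congr 1
    · exact Finset.prod_congr rfl fun j hj => by rw [if_pos (Finset.mem_range.1 hj)]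
    · exact Finset.prod_congr rfl fun j hj => by simp
  rw [← hprod, krylovDet, blockDet, ← Matrix.det_mul_column, ← Matrix.det_transpose, phiDet,
    doubleWronskian]
  congr 1
  ext i j
  simp only [Matrix.transpose_apply, Matrix.of_apply, h₁, h₂]
  split_ifs
  · rw [smul_pow, Matrix.smul_mulVec, Matrix.mulVec_smul, Matrix.mulVec_mulVec, ← pow_add]
    rfl
  · rw [smul_pow, Matrix.smul_mulVec, Matrix.mulVec_smul, Matrix.mulVec_mulVec, mul_assoc,
      (hS.pow_right _).eq, ← mul_assoc, ← pow_add, ← Matrix.mulVec_mulVec]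
    rfl

end Determinants

/-! ### Normalisation of `f`, `h̃`, `h`, `g`, `s`. -/

section TauFunctions

variable {m : ℕ} {A S : Matrix (Fin (2 * (m + 1))) (Fin (2 * (m + 1))) ℂ}

/-- The inverses of `-2i` and `2i` are `c = i/2` and `-c`, so the prefactors compensate for the
unequal lengths of the products of powers of `±c`. What remains is one constant `κ` for `f, h̃, h`
and one constant `μ` for `g, s`. -/
lemma tauFunctions_eq (C : Fin (2 * (m + 1)) → ℂ) (hA : IsUnit A) (hS : Commute S (A ^ 2)) :
    ∃ κ μ : ℂ, κ ≠ 0 ∧ μ ≠ 0 ∧ ∀ x t : ℝ,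
      f A S C x t =
        κ * krylovDet (A ^ 2) (phi A C x t) (S *ᵥ phi A C (-x) (-t)) (m + 1) 1 0 ∧
      hTilde A S C x t = -A.det * κ *
        krylovDet (A ^ 2) (phi A C x t) (S *ᵥ phi A C (-x) (-t)) (m + 2) 0 0 ∧
      h A S C x t = Complex.I * A.det⁻¹ * κ *
        krylovDet (A ^ 2) (phi A C x t) (S *ᵥ phi A C (-x) (-t)) m 2 0 ∧
      g A S C x t = Complex.I * A.det * μ *
        krylovDet (A ^ 2) (phi A C x t) (S *ᵥ phi A C (-x) (-t)) (m + 2) 0 1 ∧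
      s A S C x t = A.det ^ 2 * μ *
        krylovDet (A ^ 2) (phi A C x t) (S *ᵥ phi A C (-x) (-t)) (m + 1) 0 0 := by
  set c : ℂ := Complex.I / 2 with hc
  have hc0 : c ≠ 0 := by simp [hc]
  have e₁ : (-2 * Complex.I) ^ (-((m + 1 : ℕ) : ℤ)) = c ^ (m + 1) := by
    rw [_root_.zpow_neg, zpow_natCast, ← inv_pow]
    congr 1
    rw [hc, mul_inv, Complex.inv_I]
    ring
  have e₂ : (2 * Complex.I) ^ (1 - ((m + 1 : ℕ) : ℤ)) = (-c) ^ m := by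
    rw [show (1 - ((m + 1 : ℕ) : ℤ)) = -(m : ℤ) by push_cast; ring, _root_.zpow_neg, zpow_natCast,
      ← inv_pow]
    congr 1
    rw [hc, mul_inv, Complex.inv_I]
    ring
  have e₃ : (-1 : ℂ) ^ (((m + 1 : ℕ) : ℤ) - 1) = (-1) ^ m := by
    rw [show ((m + 1 : ℕ) : ℤ) - 1 = (m : ℤ) by push_cast; ring, zpow_natCast]
  have e₄ : (2 : ℂ) ^ (1 - 2 * ((m + 1 : ℕ) : ℤ)) = 2 * 2 ^ (-2 * ((m + 1 : ℕ) : ℤ)) := by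
    rw [show 1 - 2 * ((m + 1 : ℕ) : ℤ) = 1 + -2 * ((m + 1 : ℕ) : ℤ) by ring,
      zpow_add₀ (by norm_num), zpow_one]
  have hneg : (-c) ^ m = (-1) ^ m * c ^ m := by rw [← mul_pow]; norm_num
  have hsq : ((-1 : ℂ) ^ m) * (-1) ^ m = 1 := by rw [← mul_pow]; norm_num
  have hp : ∀ (d : ℂ), d ≠ 0 → ∀ k, ∏ j ∈ Finset.range k, d ^ j ≠ 0 := fun d hd k =>
    Finset.prod_ne_zero_iff.2 fun j _ => pow_ne_zero _ hd
  refine ⟨c ^ (m + 1) * (∏ j ∈ Finset.range (m + 1), c ^ j) *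
      (∏ j ∈ Finset.range (m + 1), (-c) ^ j),
    2 ^ (-2 * ((m + 1 : ℕ) : ℤ)) * (∏ j ∈ Finset.range (m + 1), c ^ j) *
      (∏ j ∈ Finset.range (m + 1), (-c) ^ j), ?_, ?_, fun x t => ⟨?_, ?_, ?_, ?_, ?_⟩⟩
  · exact mul_ne_zero (mul_ne_zero (pow_ne_zero _ hc0) (hp _ hc0 _)) (hp _ (neg_ne_zero.2 hc0) _)
  · exact mul_ne_zero (mul_ne_zero (zpow_ne_zero _ two_ne_zero) (hp _ hc0 _))
      (hp _ (neg_ne_zero.2 hc0) _)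
  · have hD := phiDet_eq C hA hS (by omega : (m + 1) + (m + 1) = _) 1 0 x t
    rw [pow_one, pow_zero, one_mul, ← hc] at hD
    rw [f, hD, e₁]
    ring
  · have hD := phiDet_eq C hA hS (by omega : (m + 2) + m = _) 0 0 x t
    rw [pow_zero, one_mul, ← hc] at hD
    rw [hTilde, hD, e₂, Finset.prod_range_succ _ (m + 1), Finset.prod_range_succ (fun j => (-c) ^ j)]
    ring
  · have hD := phiDet_eq C hA hS (by omega : m + (m + 2) = _) 2 0 x t
    rw [← pow_mul, pow_zero, one_mul, ← hc] at hD
    rw [h, show m + 1 - 1 = m from rfl, hD, e₂, Finset.prod_range_succ (fun j => (-c) ^ j) (m + 1),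
      Finset.prod_range_succ (fun j => c ^ j) m, pow_succ (-c), hneg]
    linear_combination Complex.I * c * c ^ m * c ^ m * A.det⁻¹ *
      (∏ j ∈ Finset.range m, c ^ j) * (∏ j ∈ Finset.range (m + 1), (-c) ^ j) *
      krylovDet (A ^ 2) (phi A C x t) (S *ᵥ phi A C (-x) (-t)) m 2 0 * hsq
  · have hD := phiDet_eq C hA hS (by omega : (m + 2) + m = _) 0 1 x t
    rw [pow_zero, pow_one, ← hc] at hD
    rw [g, hD, e₃, e₄, Finset.prod_range_succ _ (m + 1),
      Finset.prod_range_succ (fun j => (-c) ^ j), hneg, pow_succ c, show Complex.I = 2 * c by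
        rw [hc]; ring]
    ring
  · have hD := phiDet_eq C hA hS (by omega : (m + 1) + (m + 1) = _) 0 0 x t
    rw [pow_zero, one_mul, ← hc] at hD
    rw [s, hD]
    ring

end TauFunctions

/-! ### Reflection symmetry and the nonlocal massive Thirring equations. -/

section Equations

variable {m : ℕ} {A S : Matrix (Fin (2 * (m + 1))) (Fin (2 * (m + 1))) ℂ} {δ : ℂ}

lemma commute_of_sq_eq (hAS : A ^ 2 = δ • S ^ 2) : Commute S (A ^ 2) := by
  rw [hAS]; exact ((Commute.refl S).pow_right 2).smul_right δ

lemma hasDerivAt_krylovDet_ratio_right (C : Fin (2 * (m + 1)) → ℂ) (hA : IsUnit A)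
    (hS : Commute S (A ^ 2)) (x t : ℝ)
    (h₀ : krylovDet (A ^ 2) (phi A C x t) (S *ᵥ phi A C (-x) (-t)) (m + 1) 1 0 ≠ 0) :
    HasDerivAt (fun τ : ℝ =>
        krylovDet (A ^ 2) (phi A C x τ) (S *ᵥ phi A C (-x) (-τ)) (m + 2) 0 0 /
        krylovDet (A ^ 2) (phi A C x τ) (S *ᵥ phi A C (-x) (-τ)) (m + 1) 1 0)
      (Complex.I * krylovDet (A ^ 2) (phi A C x t) (S *ᵥ phi A C (-x) (-t)) (m + 2) 0 1 *
        krylovDet (A ^ 2) (phi A C x t) (S *ᵥ phi A C (-x) (-t)) (m + 1) 2 0 /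
        (A.det ^ 2 * krylovDet (A ^ 2) (phi A C x t) (S *ᵥ phi A C (-x) (-t)) (m + 1) 1 0 ^ 2))
      t := by
  have hu : IsUnit (A ^ 2).det := (Matrix.isUnit_iff_isUnit_det _).1 (hA.pow 2)
  have hSi : Commute (A ^ 2)⁻¹ S := by
    have h := congrArg (fun M => (A ^ 2)⁻¹ * M * (A ^ 2)⁻¹) hS.eq
    simp only [← mul_assoc, Matrix.nonsing_inv_mul _ hu, one_mul] at h
    simp only [mul_assoc, Matrix.mul_nonsing_inv _ hu, mul_one] at h
    exact h
  have hr := hasDerivAt_ratio_down (A ^ 2) (phi A C x t) (S *ᵥ phi A C (-x) (-t))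
    (Matrix.mul_nonsing_inv _ hu) (-Complex.I) h₀
  rw [← sub_self t] at hr
  have hq := HasDerivAt.comp_sub_const t t hr
  rw [neg_neg, Matrix.det_pow] at hq
  have e : ∀ τ, phi A C (-x) (-τ) =
      NormedSpace.exp (-((τ - t) • ((Complex.I / 2) • (A ^ 2)⁻¹))) *ᵥ phi A C (-x) (-t) := by
    intro τ
    rw [phi_add_right C hA (-x) (-t) (-τ), ← neg_smul]
    congr 3
    ring
  have hflow : ∀ (τ : ℝ) (k a b : ℕ), k ≤ 2 * (m + 1) →
      krylovDet (A ^ 2) (phi A C x τ) (S *ᵥ phi A C (-x) (-τ)) k a b =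
      (NormedSpace.exp ((τ - t) • ((Complex.I / 2) • (A ^ 2)⁻¹))).det *
        krylovDet (A ^ 2) (phi A C x t) (NormedSpace.exp ((τ - t) • ((-Complex.I) • (A ^ 2)⁻¹)) *ᵥ
          (S *ᵥ phi A C (-x) (-t))) k a b := by
    intro τ k a b hk
    rw [phi_add_right C hA x t τ, e τ, krylovDet_flow (commute_sq_inv hA).symm hSi _ _ _ hk]
  refine hq.congr_of_eventuallyEq (Filter.Eventually.of_forall fun τ => ?_)
  have h₁ := hflow τ (m + 2) 0 0 (by omega)
  have h₂ := hflow τ (m + 1) 1 0 (by omega)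
  simp only [h₁, h₂]
  exact mul_div_mul_left _ _ (det_exp_ne_zero _)

lemma hasDerivAt_krylovDet_ratio_left (C : Fin (2 * (m + 1)) → ℂ) (hA : IsUnit A)
    (hS : Commute S (A ^ 2)) (x t : ℝ)
    (h₀ : krylovDet (A ^ 2) (phi A C x t) (S *ᵥ phi A C (-x) (-t)) (m + 1) 0 0 ≠ 0) :
    HasDerivAt (fun ξ : ℝ =>
        krylovDet (A ^ 2) (phi A C ξ t) (S *ᵥ phi A C (-ξ) (-t)) (m + 2) 0 1 /
        krylovDet (A ^ 2) (phi A C ξ t) (S *ᵥ phi A C (-ξ) (-t)) (m + 1) 0 0)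
      (Complex.I * krylovDet (A ^ 2) (phi A C x t) (S *ᵥ phi A C (-x) (-t)) (m + 2) 0 0 *
        krylovDet (A ^ 2) (phi A C x t) (S *ᵥ phi A C (-x) (-t)) (m + 1) 0 1 /
        krylovDet (A ^ 2) (phi A C x t) (S *ᵥ phi A C (-x) (-t)) (m + 1) 0 0 ^ 2)
      x := by
  have hr := hasDerivAt_ratio_up (A ^ 2) (phi A C x t) (S *ᵥ phi A C (-x) (-t))
    (-Complex.I) h₀
  rw [← sub_self x] at hr
  have hq := HasDerivAt.comp_sub_const x x hr
  rw [neg_neg] at hq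
  have e : ∀ ξ, phi A C (-ξ) (-t) =
      NormedSpace.exp (-((ξ - x) • ((Complex.I / 2) • A ^ 2))) *ᵥ phi A C (-x) (-t) := by
    intro ξ
    rw [phi_add_left C hA (-x) (-ξ) (-t), ← neg_smul]
    congr 3
    ring
  have hflow : ∀ (ξ : ℝ) (k a b : ℕ), k ≤ 2 * (m + 1) →
      krylovDet (A ^ 2) (phi A C ξ t) (S *ᵥ phi A C (-ξ) (-t)) k a b =
      (NormedSpace.exp ((ξ - x) • ((Complex.I / 2) • A ^ 2))).det *
        krylovDet (A ^ 2) (phi A C x t) (NormedSpace.exp ((ξ - x) • ((-Complex.I) • A ^ 2)) *ᵥ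
          (S *ᵥ phi A C (-x) (-t))) k a b := by
    intro ξ k a b hk
    rw [phi_add_left C hA x ξ t, e ξ, krylovDet_flow (Commute.refl _) hS.symm _ _ _ hk]
  refine hq.congr_of_eventuallyEq (Filter.Eventually.of_forall fun ξ => ?_)
  have h₁ := hflow ξ (m + 2) 0 1 (by omega)
  have h₂ := hflow ξ (m + 1) 0 0 (by omega)
  simp only [h₁, h₂]
  exact mul_div_mul_left _ _ (det_exp_ne_zero _)

lemma krylovDet_neg (C : Fin (2 * (m + 1)) → ℂ) (hAS : A ^ 2 = δ • S ^ 2) {k l : ℕ}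
    (hkl : k + l = 2 * (m + 1)) (a b : ℕ) (x t : ℝ) :
    krylovDet (A ^ 2) (phi A C (-x) (-t)) (S *ᵥ phi A C (- -x) (- -t)) k (a + 1) b =
      (-1) ^ (k * l) * S.det * δ ^ k *
        krylovDet (A ^ 2) (phi A C x t) (S *ᵥ phi A C (-x) (-t)) l b a := by
  rw [neg_neg, neg_neg, krylovDet_reverse (A ^ 2) (phi A C x t) (phi A C (-x) (-t)) S δ hAS hkl]

lemma det_ne_zero_of_sq_eq (hA : IsUnit A) (hAS : A ^ 2 = δ • S ^ 2) : S.det ≠ 0 := by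
  intro h0
  have hu : IsUnit (A ^ 2).det := (Matrix.isUnit_iff_isUnit_det _).1 (hA.pow 2)
  rw [hAS, Matrix.det_smul, Matrix.det_pow, h0] at hu
  simp at hu

variable (C : Fin (2 * (m + 1)) → ℂ)

lemma s_ne_zero_iff (hA : IsUnit A) (hδ : δ ^ 2 = 1) (hAS : A ^ 2 = δ • S ^ 2)
    (x t : ℝ) : s A S C x t ≠ 0 ↔ f A S C (-x) (-t) ≠ 0 := by
  obtain ⟨κ, μ, hκ, hμ, H⟩ := tauFunctions_eq C hA (commute_of_sq_eq hAS)
  have hα : A.det ≠ 0 := ((Matrix.isUnit_iff_isUnit_det _).1 hA).ne_zero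
  have hδ0 : δ ≠ 0 := by rintro rfl; simp at hδ
  rw [(H x t).2.2.2.2, (H (-x) (-t)).1, krylovDet_neg C hAS (by omega : m + 1 + (m + 1) = _) 0 0]
  simp [hκ, hμ, hα, hδ0, det_ne_zero_of_sq_eq hA hAS]

lemma g_div_s_eq (hA : IsUnit A) (hδ : δ ^ 2 = 1) (hAS : A ^ 2 = δ • S ^ 2)
    (x t : ℝ) (hs : s A S C x t ≠ 0) :
    Complex.I * (g A S C x t / s A S C x t) =
      -Complex.I * δ * (h A S C (-x) (-t) / f A S C (-x) (-t)) := by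
  obtain ⟨κ, μ, hκ, hμ, H⟩ := tauFunctions_eq C hA (commute_of_sq_eq hAS)
  have hα : A.det ≠ 0 := ((Matrix.isUnit_iff_isUnit_det _).1 hA).ne_zero
  have hδ0 : δ ≠ 0 := by rintro rfl; simp at hδ
  have hσ := det_ne_zero_of_sq_eq hA hAS
  have hε : ((-1 : ℂ) ^ m) ≠ 0 := pow_ne_zero _ (by norm_num)
  rw [(H x t).2.2.2.2] at hs ⊢
  have h₀ := right_ne_zero_of_mul hs
  rw [(H x t).2.2.2.1, (H (-x) (-t)).1, (H (-x) (-t)).2.2.1,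
    krylovDet_neg C hAS (by omega : m + 1 + (m + 1) = _) 0 0,
    krylovDet_neg C hAS (by omega : m + (m + 2) = _) 1 0]
  have e₁ : (-1 : ℂ) ^ (m * (m + 2)) = (-1) ^ m := by
    rw [show m * (m + 2) = m * (m + 1) + m by ring, pow_add, (Nat.even_mul_succ_self m).neg_one_pow,
      one_mul]
  have e₂ : (-1 : ℂ) ^ ((m + 1) * (m + 1)) = -(-1) ^ m := by
    rw [show (m + 1) * (m + 1) = m * (m + 1) + m + 1 by ring, pow_succ, pow_add,
      (Nat.even_mul_succ_self m).neg_one_pow]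
    ring
  rw [e₁, e₂]
  field_simp
  ring

lemma q₁_neg (hA : IsUnit A) (hδ : δ ^ 2 = 1) (hAS : A ^ 2 = δ • S ^ 2)
    (x t : ℝ) (hs : s A S C x t ≠ 0) :
    q₁ A S C (-x) (-t) = δ * A.det⁻¹ *
      (krylovDet (A ^ 2) (phi A C x t) (S *ᵥ phi A C (-x) (-t)) m 1 0 /
        krylovDet (A ^ 2) (phi A C x t) (S *ᵥ phi A C (-x) (-t)) (m + 1) 0 0) := by
  obtain ⟨κ, μ, hκ, hμ, H⟩ := tauFunctions_eq C hA (commute_of_sq_eq hAS)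
  have hα : A.det ≠ 0 := ((Matrix.isUnit_iff_isUnit_det _).1 hA).ne_zero
  have hδ0 : δ ≠ 0 := by rintro rfl; simp at hδ
  have hσ := det_ne_zero_of_sq_eq hA hAS
  have hε : ((-1 : ℂ) ^ m) ≠ 0 := pow_ne_zero _ (by norm_num)
  rw [(H x t).2.2.2.2] at hs
  have h₀ := right_ne_zero_of_mul hs
  have e₁ : (-1 : ℂ) ^ ((m + 2) * m) = (-1) ^ m := by
    rw [show (m + 2) * m = m * (m + 1) + m by ring, pow_add, (Nat.even_mul_succ_self m).neg_one_pow,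
      one_mul]
  have e₂ : (-1 : ℂ) ^ ((m + 1) * (m + 1)) = -(-1) ^ m := by
    rw [show (m + 1) * (m + 1) = m * (m + 1) + m + 1 by ring, pow_succ, pow_add,
      (Nat.even_mul_succ_self m).neg_one_pow]
    ring
  -- Reflection needs a positive first exponent, so `K (m+2) 0 0` is reached through `K (m+2) 1 1 =
  -- det B * K (m+2) 0 0`.
  have hH := krylovDet_neg C hAS (by omega : m + 2 + m = _) 0 1 x t
  rw [krylovDet_succ_succ _ _ _ (by omega), Matrix.det_pow, e₁] at hH
  rw [q₁, (H (-x) (-t)).1, (H (-x) (-t)).2.1,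
    krylovDet_neg C hAS (by omega : m + 1 + (m + 1) = _) 0 0, e₂]
  rw [eq_div_of_mul_eq (pow_ne_zero 2 hα) ((mul_comm _ _).trans hH)]
  field_simp
  ring

lemma q₃_neg (hA : IsUnit A) (hδ : δ ^ 2 = 1) (hAS : A ^ 2 = δ • S ^ 2)
    (x t : ℝ) (hf : f A S C x t ≠ 0) :
    q₃ A S C (-x) (-t) = δ * A.det⁻¹ *
      (krylovDet (A ^ 2) (phi A C x t) (S *ᵥ phi A C (-x) (-t)) m 2 0 /
        krylovDet (A ^ 2) (phi A C x t) (S *ᵥ phi A C (-x) (-t)) (m + 1) 1 0) := by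
  obtain ⟨κ, μ, hκ, hμ, H⟩ := tauFunctions_eq C hA (commute_of_sq_eq hAS)
  have hα : A.det ≠ 0 := ((Matrix.isUnit_iff_isUnit_det _).1 hA).ne_zero
  have hs : s A S C (-x) (-t) ≠ 0 := by
    rw [s_ne_zero_iff C hA hδ hAS, neg_neg, neg_neg]; exact hf
  rw [q₃, g_div_s_eq C hA hδ hAS _ _ hs, neg_neg, neg_neg]
  rw [(H x t).1] at hf ⊢
  have h₀ := right_ne_zero_of_mul hf
  rw [(H x t).2.2.1]
  field_simp
  rw [Complex.I_sq]
  ring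

lemma q₁_eq (hA : IsUnit A) (hAS : A ^ 2 = δ • S ^ 2) (x t : ℝ) :
    q₁ A S C x t = -A.det *
      (krylovDet (A ^ 2) (phi A C x t) (S *ᵥ phi A C (-x) (-t)) (m + 2) 0 0 /
        krylovDet (A ^ 2) (phi A C x t) (S *ᵥ phi A C (-x) (-t)) (m + 1) 1 0) := by
  obtain ⟨κ, μ, hκ, hμ, H⟩ := tauFunctions_eq C hA (commute_of_sq_eq hAS)
  rw [q₁, (H x t).1, (H x t).2.1, mul_right_comm, ← mul_div_assoc, mul_comm κ,
    mul_div_mul_right _ _ hκ]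

lemma q₃_eq (hA : IsUnit A) (hAS : A ^ 2 = δ • S ^ 2) (x t : ℝ) :
    q₃ A S C x t = -A.det⁻¹ *
      (krylovDet (A ^ 2) (phi A C x t) (S *ᵥ phi A C (-x) (-t)) (m + 2) 0 1 /
        krylovDet (A ^ 2) (phi A C x t) (S *ᵥ phi A C (-x) (-t)) (m + 1) 0 0) := by
  obtain ⟨κ, μ, hκ, hμ, H⟩ := tauFunctions_eq C hA (commute_of_sq_eq hAS)
  have hα : A.det ≠ 0 := ((Matrix.isUnit_iff_isUnit_det _).1 hA).ne_zero
  rw [q₃, (H x t).2.2.2.1, (H x t).2.2.2.2]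
  -- Where the denominator vanishes both sides are `0` by the convention for division. The identity
  -- thus holds on the whole plane and may be used under `deriv`.
  rcases eq_or_ne (krylovDet (A ^ 2) (phi A C x t) (S *ᵥ phi A C (-x) (-t)) (m + 1) 0 0) 0
    with h₀ | h₀
  · simp [h₀]
  · field_simp
    rw [Complex.I_sq]
    ring

lemma equation_right (hA : IsUnit A) (hδ : δ ^ 2 = 1) (hAS : A ^ 2 = δ • S ^ 2) (x t : ℝ)
    (hf : f A S C x t ≠ 0) (hs : s A S C x t ≠ 0) :
    Complex.I * deriv (fun τ : ℝ => q₁ A S C x τ) t + q₃ A S C x t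
      + δ * q₁ A S C x t * q₃ A S C x t * q₃ A S C (-x) (-t) = 0 := by
  have hα : A.det ≠ 0 := ((Matrix.isUnit_iff_isUnit_det _).1 hA).ne_zero
  have hn := q₃_neg C hA hδ hAS x t hf
  obtain ⟨κ, μ, hκ, hμ, H⟩ := tauFunctions_eq C hA (commute_of_sq_eq hAS)
  rw [(H x t).1] at hf
  rw [(H x t).2.2.2.2] at hs
  have hF := right_ne_zero_of_mul hf
  have hσ := right_ne_zero_of_mul hs
  have hd := (hasDerivAt_krylovDet_ratio_right C hA (commute_of_sq_eq hAS) x t hF).const_mul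
    (-A.det)
  simp only [← q₁_eq C hA hAS] at hd
  rw [hd.deriv, hn, q₁_eq C hA hAS, q₃_eq C hA hAS]
  -- At `(a, b) = (1, 0)` every product contains exactly one shifted determinant, so a common factor
  -- `det B = (det A)²` can be divided out.
  have hb := krylovDet_bilinear (A ^ 2) (phi A C x t) (S *ᵥ phi A C (-x) (-t)) 1 0
  rw [krylovDet_succ_succ _ _ _ (by omega) 0 0, krylovDet_succ_succ _ _ _ (by omega) 1 0,
    krylovDet_succ_succ _ _ _ (by omega) 0 0, Matrix.det_pow] at hb
  set K := krylovDet (A ^ 2) (phi A C x t) (S *ᵥ phi A C (-x) (-t)) with hK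
  have hb' : A.det ^ 2 * (K (m + 2) 0 0 * K m 2 0 - K (m + 1) 1 0 ^ 2
      + K (m + 1) 0 0 * K (m + 1) 2 0) = 0 := by linear_combination hb
  have hb'' := (mul_eq_zero.1 hb').resolve_left (pow_ne_zero 2 hα)
  field_simp
  linear_combination K (m + 2) 0 1 * hb'' - K (m + 2) 0 1 * K (m + 1) 0 0 * K (m + 1) 2 0 *
    Complex.I_sq + K (m + 2) 0 1 * K (m + 2) 0 0 * K m 2 0 * hδ

lemma equation_left (hA : IsUnit A) (hδ : δ ^ 2 = 1) (hAS : A ^ 2 = δ • S ^ 2) (x t : ℝ)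
    (hf : f A S C x t ≠ 0) (hs : s A S C x t ≠ 0) :
    Complex.I * deriv (fun ξ : ℝ => q₃ A S C ξ t) x + q₁ A S C x t
      + δ * q₃ A S C x t * q₁ A S C x t * q₁ A S C (-x) (-t) = 0 := by
  have hα : A.det ≠ 0 := ((Matrix.isUnit_iff_isUnit_det _).1 hA).ne_zero
  have hn := q₁_neg C hA hδ hAS x t hs
  obtain ⟨κ, μ, hκ, hμ, H⟩ := tauFunctions_eq C hA (commute_of_sq_eq hAS)
  rw [(H x t).1] at hf
  rw [(H x t).2.2.2.2] at hs
  have hF := right_ne_zero_of_mul hf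
  have hσ := right_ne_zero_of_mul hs
  have hd := (hasDerivAt_krylovDet_ratio_left C hA (commute_of_sq_eq hAS) x t hσ).const_mul
    (-A.det⁻¹)
  simp only [← q₃_eq C hA hAS] at hd
  rw [hd.deriv, hn, q₁_eq C hA hAS, q₃_eq C hA hAS]
  have hb := krylovDet_bilinear (A ^ 2) (phi A C x t) (S *ᵥ phi A C (-x) (-t)) 0 0
  rw [krylovDet_succ_succ _ _ _ (by omega) 0 0, Matrix.det_pow] at hb
  set K := krylovDet (A ^ 2) (phi A C x t) (S *ᵥ phi A C (-x) (-t)) with hK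
  simp only [zero_add] at hb
  field_simp
  -- Apart from the bilinear identity only `i² = -1`, from the derivative, and `δ² = 1`, from the
  -- reflected factor, enter.
  linear_combination K (m + 2) 0 0 * hb - K (m + 2) 0 0 * K (m + 1) 0 1 * K (m + 1) 1 0 *
    Complex.I_sq + K (m + 2) 0 0 * K (m + 2) 0 1 * K m 1 0 * hδ

lemma contDiff_krylovDet_phi (A S : Matrix (Fin (2 * (m + 1))) (Fin (2 * (m + 1))) ℂ)
    (C : Fin (2 * (m + 1)) → ℂ) (k a b : ℕ) :
    ContDiff ℝ ∞ fun p : ℝ × ℝ =>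
      krylovDet (A ^ 2) (phi A C p.1 p.2) (S *ᵥ phi A C (-p.1) (-p.2)) k a b := by
  refine contDiff_krylovDet (u := fun p : ℝ × ℝ => phi A C p.1 p.2)
    (v := fun p : ℝ × ℝ => S *ᵥ phi A C (-p.1) (-p.2)) (contDiff_phi A C) (fun i => ?_) k a b
  have h : ∀ j, ContDiff ℝ ∞ fun p : ℝ × ℝ => phi A C (-p.1) (-p.2) j := fun j =>
    ContDiff.comp (g := fun p : ℝ × ℝ => phi A C p.1 p.2 j) (f := fun p : ℝ × ℝ => (-p.1, -p.2))
      (contDiff_phi A C j) (contDiff_fst.neg.prodMk contDiff_snd.neg)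
  simp only [Matrix.mulVec, dotProduct]
  exact ContDiff.sum fun j _ => contDiff_const.mul (h j)

lemma isSolutionOn (hA : IsUnit A) (hδ : δ ^ 2 = 1) (hAS : A ^ 2 = δ • S ^ 2) :
    IsSolutionOn δ {p : ℝ × ℝ | f A S C p.1 p.2 ≠ 0 ∧ s A S C p.1 p.2 ≠ 0}
      (q₁ A S C) (q₃ A S C) := by
  obtain ⟨κ, μ, hκ, hμ, H⟩ := tauFunctions_eq C hA (commute_of_sq_eq hAS)
  have hcf : ContDiff ℝ ∞ fun p : ℝ × ℝ => f A S C p.1 p.2 := by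
    simp only [fun x t => (H x t).1]
    exact contDiff_const.mul (contDiff_krylovDet_phi A S C _ _ _)
  have hch : ContDiff ℝ ∞ fun p : ℝ × ℝ => hTilde A S C p.1 p.2 := by
    simp only [fun x t => (H x t).2.1]
    exact contDiff_const.mul (contDiff_krylovDet_phi A S C _ _ _)
  have hcg : ContDiff ℝ ∞ fun p : ℝ × ℝ => g A S C p.1 p.2 := by
    simp only [fun x t => (H x t).2.2.2.1]
    exact contDiff_const.mul (contDiff_krylovDet_phi A S C _ _ _)
  have hcs : ContDiff ℝ ∞ fun p : ℝ × ℝ => s A S C p.1 p.2 := by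
    simp only [fun x t => (H x t).2.2.2.2]
    exact contDiff_const.mul (contDiff_krylovDet_phi A S C _ _ _)
  refine ⟨(isOpen_ne_fun hcf.continuous continuous_const).inter
    (isOpen_ne_fun hcs.continuous continuous_const), ?_, ?_, ?_, ?_⟩
  · rintro x t ⟨hf, hs⟩
    refine ⟨(s_ne_zero_iff C hA hδ hAS x t).1 hs, (s_ne_zero_iff C hA hδ hAS (-x) (-t)).2 ?_⟩
    simpa using hf
  · simp only [q₁, div_eq_mul_inv]
    exact hch.contDiffOn.mul (hcf.contDiffOn.inv fun p hp => hp.1)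
  · simp only [q₃, div_eq_mul_inv]
    exact contDiffOn_const.mul (hcg.contDiffOn.mul (hcs.contDiffOn.inv fun p hp => hp.2))
  · rintro x t ⟨hf, hs⟩
    exact ⟨equation_right C hA hδ hAS x t hf hs, equation_left C hA hδ hAS x t hf hs⟩

end Equations

end NonlocalMTM

theorem mainTheorem3 (N : ℕ) (hN : 1 ≤ N) (δ : ℂ) (hδ : δ = 1 ∨ δ = -1)
    (A S : Matrix (Fin (2 * N)) (Fin (2 * N)) ℂ) (hA : IsUnit A) (hAS : A ^ 2 = δ • S ^ 2)
    (C : Fin (2 * N) → ℂ) :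
    (∀ x t : ℝ, NonlocalMTM.s A S C x t ≠ 0 ↔ NonlocalMTM.f A S C (-x) (-t) ≠ 0) ∧
    (∀ x t : ℝ, NonlocalMTM.s A S C x t ≠ 0 →
      Complex.I * (NonlocalMTM.g A S C x t / NonlocalMTM.s A S C x t) =
        -Complex.I * δ * (NonlocalMTM.h A S C (-x) (-t) / NonlocalMTM.f A S C (-x) (-t))) ∧
    NonlocalMTM.IsSolutionOn δ
      {p : ℝ × ℝ | NonlocalMTM.f A S C p.1 p.2 ≠ 0 ∧ NonlocalMTM.s A S C p.1 p.2 ≠ 0}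
      (NonlocalMTM.q₁ A S C) (NonlocalMTM.q₃ A S C) := by
  obtain ⟨m, rfl⟩ : ∃ m, N = m + 1 := ⟨N - 1, by omega⟩
  have hδ2 : δ ^ 2 = 1 := by rcases hδ with rfl | rfl <;> norm_num
  exact ⟨NonlocalMTM.s_ne_zero_iff C hA hδ2 hAS, NonlocalMTM.g_div_s_eq C hA hδ2 hAS,
    NonlocalMTM.isSolutionOn C hA hδ2 hAS⟩
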